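/- **Structured semigroups.** A structured semigroup $(S,N,Z)$ consists of a semigroup $S$ and subsemigroups $Z\subseteq N\subseteq S$ such that every $z\in Z$ commutes with every $n\in N$; $ab,ba\in Z$ implies $aZb\cup bZa\subseteq Z$; and $abn=n=nab$ with $n\in N$ and $ab,ba\in Z$ implies $bna\in N$. The subsemigroup $Z$ is symmetric if $ab\in Z$ implies $baba\in Z$, for all $a,b\in S$. For $a,s,b\in S$ write $a<_s b$ if $asb=a=bsa$, $as,sa\in N$ and $bs,sb\in Z$, and write $a<b$ if $a<_sb$ for some $s\in S$. For $A\subseteq S$ put $A^<=\{b: a<b\text{ for some }a\in A\}$ and $A^*=\{s: a<_sb\text{ for some }a\in A,\ b\in S\}$. **Groupoid bundles.** Groupoids are regarded as sets of arrows, with unit space $G^0$, source $\mathsf s(g)=g^{-1}g$ and range $\mathsf r(g)=gg^{-1}$, the product $gh$ being defined iff $\mathsf s(g)=\mathsf r(h)$. A topological groupoid has continuous inverse and product, and it is étale if $\mathsf s:G\to G$ is an open map. A slice is a set on which $\mathsf s$ and $\mathsf r$ are injective. A groupoid bundle is an open continuous functor $\pi:F\to G$, injective on units, from a topological groupoid $F$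 to an étale groupoid $G$. A slice-section of $\pi$ is a continuous map $a$, defined on an open slice $\operatorname{dom}(a)\subseteq G$, with $\pi(a(g))=g$ for all $g\in\operatorname{dom}(a)$. The product of slice-sections is given by $\operatorname{dom}(ab)=\operatorname{dom}(a)\operatorname{dom}(b)$ and $(ab)(gh)=a(g)b(h)$. **Representations.** A bundle representation of $(S,N,Z)$ on $\pi$ is a semigroup homomorphism $\theta$ from $S$ to the slice-sections of $\pi$ such that the sets $\operatorname{dom}(\theta(a))$, $a\in S$, cover $G$; $\operatorname{dom}(\theta(n))\subseteq G^0$ for $n\in N$; and whenever $g\in\operatorname{dom}(\theta(a))$ there is $b<a$ with $g\in\operatorname{dom}(\theta(b))$. It is faithful if $\theta$ is injective. **The coset bundle.** A coset is a set $C\subseteq S$ with $CC^*C\subseteq C=C^<$. The set $\mathcal C(S)$ of non-empty cosets carries the inverse $C\mapsto C^*$, the product $B\cdot C=(BC)^<$, defined when $(B^*B)^<=(CC^*)^<$, and the topology with subbasis $\mathcal C_a=\{C\in\mathcal C(S):a\in C\}$, $a\in S$. For $C\in\mathcal C(S)$, define the relation $\sim_C$ on $C$ by: $a\sim_Cb$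 iff $a,b\in C$ and $sat=sbt$ for some $s,t\in C^*$ (so $a\not\sim_Cb$ if $a\notin C$ or $b\notin C$). For $c\in C\in\mathcal C(S)$, let $[c,C]$ be the pair consisting of the $\sim_C$-class of $c$ and the coset $C$, and let $\widetilde{\mathcal C}(S)$ be the set of all these pairs, with the product $[a,A][b,B]=[ab,A\cdot B]$, defined when $A\cdot B$ is, the inverse $[c,C]^{-1}=[c',C^*]$, for any $c'$ such that $d<_{c'}c$ for some $d\in C$, and the topology generated by the sets $\{[s,C]:s\in C\}$ and $\{[c,C]:c,s\in C\}$, $s\in S$. The coset bundle is the projection $\widetilde{\mathcal C}(S)\to\mathcal C(S)$, $[c,C]\mapsto C$, and the coset bundle representation is $a\mapsto\tilde a$, where $\operatorname{dom}(\tilde a)=\mathcal C_a$ and $\tilde a(C)=[a,C]$. **Corollary 10.3.** Let $(S,N,Z)$ be a structured semigroup with $Z$ symmetric. Then the coset bundle is a groupoid bundle, $a\mapsto\tilde a$ is a bundle representation of $(S,N,Z)$ on it, and the following are equivalent. 1. $(S,N,Z)$ has a faithful bundle representation. 2. The coset bundle representation of $(S,N,Z)$ is faithful. 3. For all distinct $a,b\in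 S$ there is $C\in\mathcal C(S)$ with $\{a,b\}\cap C\neq\emptyset$ and $a\not\sim_Cb$. -/

import Mathlib

open scoped Pointwise

universe u v

/-! ### Topological groupoids, given by their arrows -/

/-- The operations of a groupoid, regarded as a set of arrows: an inverse and a product.
The product is only meaningful for composable pairs, i.e. when `src g = rng h`; its value at other
pairs is never used. -/
class GroupoidOps (G : Type*) where
  inv : G → G
  mul : G → G → G

namespace GroupoidOps

variable {G : Type*} [GroupoidOps G]

/-- The source unit `g⁻¹g`. -/
def src (g : G) : G := mul (inv g) g

/-- The range unit `gg⁻¹`. -/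
def rng (g : G) : G := mul g (inv g)

/-- `gh` is defined. -/
def Composable (g h : G) : Prop := src g = rng h

/-- The unit space: those `g` for which `gg` is defined and equal to `g`. -/
def units (G : Type*) [GroupoidOps G] : Set G := {g | Composable g g ∧ mul g g = g}

/-- The pointwise product of two sets of arrows. -/
def setMul (A B : Set G) : Set G := {k | ∃ g ∈ A, ∃ h ∈ B, Composable g h ∧ mul g h = k}

/-- A slice (or bisection): the source and range maps are injective on it. -/
def IsSlice (B : Set G) : Prop := Set.InjOn src B ∧ Set.InjOn rng B

end GroupoidOps

open GroupoidOps

/-- The groupoid laws: the arrows form a category in which every arrow is invertible. -/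
structure IsGroupoid (G : Type*) [GroupoidOps G] : Prop where
  inv_inv : ∀ g : G, inv (inv g) = g
  mul_src : ∀ g : G, mul g (src g) = g
  rng_mul : ∀ g : G, mul (rng g) g = g
  src_mul : ∀ g h : G, Composable g h → src (mul g h) = src h
  rng_mul_eq : ∀ g h : G, Composable g h → rng (mul g h) = rng g
  mul_assoc : ∀ g h k : G, Composable g h → Composable h k →
    mul (mul g h) k = mul g (mul h k)

/-- A topological groupoid: inverse and (partial) product are continuous. -/
structure IsTopologicalGroupoid (G : Type*) [GroupoidOps G] [TopologicalSpace G] : Prop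
    extends IsGroupoid G where
  continuous_inv : Continuous (inv : G → G)
  continuous_mul : Continuous (fun p : {p : G × G // Composable p.1 p.2} => mul p.1.1 p.1.2)

/-- An étale groupoid: a topological groupoid whose source map is open as a map `G → G`. -/
structure IsEtaleGroupoid (G : Type*) [GroupoidOps G] [TopologicalSpace G] : Prop
    extends IsTopologicalGroupoid G where
  isOpenMap_src : IsOpenMap (src : G → G)

/-- A groupoid bundle `π : F → G`: an open continuous functor, injective on units, from a
topological groupoid to an étale groupoid. -/
structure IsGroupoidBundle {F G : Type*} [GroupoidOps F] [GroupoidOps G]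
    [TopologicalSpace F] [TopologicalSpace G] (π : F → G) : Prop where
  total : IsTopologicalGroupoid F
  base : IsEtaleGroupoid G
  isOpenMap : IsOpenMap π
  continuous : Continuous π
  map_composable : ∀ e f : F, Composable e f → Composable (π e) (π f)
  map_mul : ∀ e f : F, Composable e f → π (mul e f) = mul (π e) (π f)
  injOn_units : Set.InjOn π (units F)

/-- A slice-section of `π : F → G`: a partial function `G →. F`, defined on an open slice,
continuous there, and a section of `π`. -/
structure IsSliceSection {F G : Type*} [GroupoidOps G]
    [TopologicalSpace F] [TopologicalSpace G] (π : F → G) (a : G →. F) : Prop where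
  isOpen_dom : IsOpen a.Dom
  isSlice_dom : IsSlice a.Dom
  continuous : Continuous a.asSubtype
  section_eq : ∀ g f, f ∈ a g → π f = g

/-- `c` is the product of the slice-sections `a` and `b`: its domain is the product of their
domains, and `c(gh) = a(g)b(h)` whenever `g` and `h` are composable elements of these. Here
`f ∈ a g` means that `a` is defined at `g` with value `f`. -/
def IsSectionProduct {F G : Type*} [GroupoidOps F] [GroupoidOps G] (a b c : G →. F) : Prop :=
  ∀ k f, f ∈ c k ↔
    ∃ g h x y, x ∈ a g ∧ y ∈ b h ∧ Composable g h ∧ k = mul g h ∧ f = mul x y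

/-! ### Structured semigroups -/

/-- A structured semigroup `(S, N, Z)`: `N` is a `Z`-trinormal subsemigroup of `S`, and `Z` is a
binormal subsemigroup of `S` that is contained in the centre of `N`. -/
structure StructuredSemigroup (S : Type*) [Semigroup S] where
  N : Subsemigroup S
  Z : Subsemigroup S
  Z_le_N : Z ≤ N
  Z_comm : ∀ z ∈ Z, ∀ n ∈ N, n * z = z * n
  Z_binormal : ∀ a b : S, a * b ∈ Z → b * a ∈ Z → ∀ z ∈ Z, a * z * b ∈ Z ∧ b * z * a ∈ Z
  N_trinormal : ∀ a b n : S, n ∈ N → a * b * n = n → n * a * b = n → a * b ∈ Z → b * a ∈ Z →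
    b * n * a ∈ N

/-- A subset `Y` of a semigroup is symmetric if `ab ∈ Y` implies `baba ∈ Y`. -/
def IsSymmetricSubset {S : Type*} [Semigroup S] (Y : Set S) : Prop :=
  ∀ a b : S, a * b ∈ Y → b * a * b * a ∈ Y

namespace StructuredSemigroup

section Cosets

variable {S : Type*} [Semigroup S] (T : StructuredSemigroup S)

/-- `b` dominates `a` via `s`, written `a <ₛ b`. -/
structure DomVia (a s b : S) : Prop where
  right : a * s * b = a
  left : b * s * a = a
  memN_right : a * s ∈ T.N
  memN_left : s * a ∈ T.N
  memZ_right : b * s ∈ T.Z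
  memZ_left : s * b ∈ T.Z

/-- The domination relation `a < b`. -/
def Dominated (a b : S) : Prop := ∃ s, T.DomVia a s b

/-- The up-closure `A^<` with respect to domination. -/
def up (A : Set S) : Set S := {b | ∃ a ∈ A, T.Dominated a b}

/-- The dual `A^*`. -/
def dual (A : Set S) : Set S := {s | ∃ a ∈ A, ∃ b, T.DomVia a s b}

/-- `C` is a coset if `C C^* C ⊆ C = C^<`. -/
def IsCoset (C : Set S) : Prop := C * T.dual C * C ⊆ C ∧ C = T.up C

/-- The space of non-empty cosets. -/
@[ext]
structure Coset where
  carrier : Set S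
  isCoset : T.IsCoset carrier
  nonempty : carrier.Nonempty

/-- The relation `a ∼_A b` on `A^<`: both lie in `A^<`, and `sat = sbt` for some `s, t ∈ A^*`. -/
def Equiv (A : Set S) (a b : S) : Prop :=
  a ∈ T.up A ∧ b ∈ T.up A ∧ ∃ s ∈ T.dual A, ∃ t ∈ T.dual A, s * a * t = s * b * t

/-! The following facts show that duals and products of cosets are cosets. -/

variable {T}

theorem DomVia.of_right {a s b : S} (h : a * s * b = a) (hN : a * s ∈ T.N) (h1 : b * s ∈ T.Z)
    (h2 : s * b ∈ T.Z) : T.DomVia a s b := by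
  have hc := T.Z_comm _ h1 _ hN
  have e1 : a * s * (b * s) = a * s := by rw [← mul_assoc, h]
  have e2 : b * s * (a * s) = a * s := by rw [← hc, e1]
  refine ⟨h, ?_, hN, ?_, h1, h2⟩
  · calc b * s * a = b * s * (a * s * b) := by rw [h]
      _ = b * s * (a * s) * b := by simp only [mul_assoc]
      _ = a := by rw [e2, h]
  · have := T.N_trinormal b s (a * s) hN e2 (by rw [mul_assoc]; exact e1) h1 h2
    have e : s * (a * s) * b = s * a := by rw [mul_assoc, h]
    rwa [e] at this

theorem DomVia.of_left {a s b : S} (h : b * s * a = a) (hN : s * a ∈ T.N) (h1 : b * s ∈ T.Z)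
    (h2 : s * b ∈ T.Z) : T.DomVia a s b := by
  have hc := T.Z_comm _ h2 _ hN
  have e2 : s * b * (s * a) = s * a := by
    calc s * b * (s * a) = s * (b * s * a) := by simp only [mul_assoc]
      _ = s * a := by rw [h]
  have e1 : s * a * (s * b) = s * a := by rw [hc, e2]
  have h3 : a * s * b = a := by
    calc a * s * b = b * s * a * s * b := by rw [h]
      _ = b * (s * a * (s * b)) := by simp only [mul_assoc]
      _ = a := by rw [e1, ← mul_assoc, h]
  refine ⟨h3, h, ?_, hN, h1, h2⟩
  have := T.N_trinormal s b (s * a) hN e2 (by rw [mul_assoc]; exact e1) h2 h1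
  have e : b * (s * a) * s = a * s := by rw [← mul_assoc, h]
  rwa [e] at this

theorem DomVia.trans {a b' b c' c : S} (h : T.DomVia a b' b) (k : T.DomVia b c' c) :
    T.DomVia a c' c := by
  refine .of_right ?_ ?_ k.memZ_right k.memZ_left
  · calc a * c' * c = a * b' * b * c' * c := by rw [h.right]
      _ = a * b' * (b * c' * c) := by simp only [mul_assoc]
      _ = a := by rw [k.right, h.right]
  · have := T.N.mul_mem h.memN_right k.memN_right
    rwa [← mul_assoc, h.right] at this

theorem DomVia.switch {a b c' c : S} (h : a * b ∈ T.N) (k : T.DomVia b c' c) :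
    T.DomVia (a * b * c') c c' := by
  refine .of_right ?_ ?_ k.memZ_left k.memZ_right
  · calc a * b * c' * c * c' = a * (b * c' * c) * c' := by simp only [mul_assoc]
      _ = a * b * c' := by rw [k.right]
  · have := T.N.mul_mem h (T.Z_le_N k.memZ_left)
    rwa [← mul_assoc] at this

theorem DomVia.mul {a b' b c d' d : S} (h : T.DomVia a b' b) (k : T.DomVia c d' d) :
    T.DomVia (a * c) (d' * b') (b * d) := by
  have hn : b' * a * (c * d') ∈ T.N := T.N.mul_mem h.memN_left k.memN_right
  have e1 : b' * b * (b' * a * (c * d')) = b' * a * (c * d') := by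
    calc b' * b * (b' * a * (c * d')) = b' * (b * b' * a) * (c * d') := by simp only [mul_assoc]
      _ = _ := by rw [h.left]
  have e2 : b' * a * (c * d') * (b' * b) = b' * a * (c * d') := by
    rw [T.Z_comm _ h.memZ_left _ hn, e1]
  refine .of_right ?_ ?_ ?_ ?_
  · calc a * c * (d' * b') * (b * d) = a * ((c * d') * (b' * b)) * d := by simp only [mul_assoc]
      _ = a * ((b' * b) * (c * d')) * d := by rw [T.Z_comm _ h.memZ_left _ k.memN_right]
      _ = (a * b' * b) * (c * d' * d) := by simp only [mul_assoc]
      _ = a * c := by rw [h.right, k.right]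
  · have := T.N_trinormal b' b _ hn e1 (by rw [mul_assoc]; exact e2) h.memZ_left h.memZ_right
    have e : b * (b' * a * (c * d')) * b' = a * c * (d' * b') := by
      calc b * (b' * a * (c * d')) * b' = (b * b' * a) * c * (d' * b') := by simp only [mul_assoc]
        _ = _ := by rw [h.left]
    rwa [e] at this
  · have := (T.Z_binormal b b' h.memZ_right h.memZ_left _ k.memZ_right).1
    simpa only [mul_assoc] using this
  · have := (T.Z_binormal d' d k.memZ_left k.memZ_right _ h.memZ_left).1
    simpa only [mul_assoc] using this

theorem DomVia.mul_left {a b' b n : S} (hn : n ∈ T.N) (h : T.DomVia a b' b) :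
    T.DomVia (n * a) b' b := by
  refine .of_right ?_ ?_ h.memZ_right h.memZ_left
  · rw [mul_assoc, mul_assoc, ← mul_assoc a, h.right]
  · rw [mul_assoc]; exact T.N.mul_mem hn h.memN_right

theorem up_mono {A B : Set S} (h : A ⊆ B) : T.up A ⊆ T.up B :=
  fun _ ⟨a, ha, hb⟩ => ⟨a, h ha, hb⟩

theorem dual_mono {A B : Set S} (h : A ⊆ B) : T.dual A ⊆ T.dual B :=
  fun _ ⟨a, ha, hb⟩ => ⟨a, h ha, hb⟩

theorem up_up_subset (A : Set S) : T.up (T.up A) ⊆ T.up A := by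
  rintro c ⟨b, ⟨a, ha, b', h⟩, c', k⟩
  exact ⟨a, ha, c', h.trans k⟩

theorem up_mul_up (A B : Set S) : T.up A * T.up B ⊆ T.up (A * B) := by
  rintro _ ⟨b, ⟨a, ha, b', h⟩, d, ⟨c, hc, d', k⟩, rfl⟩
  exact ⟨a * c, Set.mul_mem_mul ha hc, d' * b', h.mul k⟩

theorem dual_mul_dual (A B : Set S) : T.dual A * T.dual B ⊆ T.dual (B * A) := by
  rintro _ ⟨d', ⟨c, hc, d, k⟩, b', ⟨a, ha, b, h⟩, rfl⟩
  exact ⟨a * c, Set.mul_mem_mul ha hc, b * d, h.mul k⟩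

theorem dual_up_subset (A : Set S) : T.dual (T.up A) ⊆ T.up (T.dual A) := by
  rintro c' ⟨b, ⟨a, ha, b', h⟩, c, k⟩
  have t := h.trans k
  have e : a * (b' * b * c') = a * c' := by rw [← mul_assoc, ← mul_assoc, h.right]
  refine ⟨b' * b * c', ⟨a, ha, c, .of_right ?_ ?_ ?_ ?_⟩, c, k.switch (T.Z_le_N h.memZ_left)⟩
  · rw [e, t.right]
  · rw [e]; exact t.memN_right
  · have := (T.Z_binormal c c' k.memZ_right k.memZ_left _ h.memZ_left).1
    simpa only [mul_assoc] using this
  · have := T.Z.mul_mem h.memZ_left k.memZ_left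
    simpa only [mul_assoc] using this

theorem up_up_subset_dual_dual (A : Set S) : T.up (T.up A) ⊆ T.dual (T.dual A) := by
  rintro c ⟨b, ⟨a, ha, b', h⟩, c', k⟩
  have t := h.trans k
  have e : a * (b' * b * c') = a * c' := by rw [← mul_assoc, ← mul_assoc, h.right]
  refine ⟨b' * b * c', ⟨a, ha, c, .of_right ?_ ?_ ?_ ?_⟩, c', k.switch (T.Z_le_N h.memZ_left)⟩
  · rw [e, t.right]
  · rw [e]; exact t.memN_right
  · have := (T.Z_binormal c c' k.memZ_right k.memZ_left _ h.memZ_left).1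
    simpa only [mul_assoc] using this
  · have := T.Z.mul_mem h.memZ_left k.memZ_left
    simpa only [mul_assoc] using this

theorem dual_triple {A : Set S} (hA : A * T.dual A * A ⊆ A) :
    T.dual A * T.dual (T.dual A) * T.dual A ⊆ T.dual A := by
  refine (Set.mul_subset_mul_right (dual_mul_dual _ _)).trans ?_
  refine (dual_mul_dual _ _).trans (dual_mono ?_)
  rwa [← mul_assoc]

theorem exists_dom_dom {A : Set S} (hA : A * T.dual A * A ⊆ A) {c b' b a a' : S} (hc : c ∈ A)
    (h : T.DomVia c b' b) (k : T.DomVia b' a a') :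
    ∃ p ∈ A, T.Dominated p (a * b' * b) ∧ T.DomVia (a * b' * b) a' a := by
  have hb' : b' ∈ T.dual A := ⟨c, hc, b, h⟩
  have ha : a ∈ T.dual (T.dual A) := ⟨b', hb', a', k⟩
  have hd : T.DomVia (a * b' * b) a' a := by
    have e : a' * (a * b' * b) = b' * b := by
      rw [← mul_assoc, ← mul_assoc, k.left]
    refine .of_left ?_ ?_ k.memZ_left k.memZ_right
    · rw [mul_assoc a, e, mul_assoc]
    · rw [e]; exact T.Z_le_N h.memZ_left
  have hs : T.DomVia (a * b' * c) (b' * b * a') (a * b' * b) := by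
    refine .of_right ?_ ?_ ?_ ?_
    · calc a * b' * c * (b' * b * a') * (a * b' * b)
          = a * b' * (c * b' * b) * (a' * a * b') * b := by simp only [mul_assoc]
        _ = a * b' * (c * b' * b) := by rw [k.left, h.right]; simp only [mul_assoc]; rw [← mul_assoc c, h.right]
        _ = a * b' * c := by rw [h.right]
    · have e1 : a' * a * (b' * c) = b' * c := by rw [← mul_assoc, k.left]
      have e2 : b' * c * (a' * a) = b' * c := by rw [T.Z_comm _ k.memZ_right _ h.memN_left, e1]
      have := T.N_trinormal a' a _ h.memN_left e1 (by rw [mul_assoc]; exact e2)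
        k.memZ_right k.memZ_left
      have e : a * b' * c * (b' * b * a') = a * (b' * c) * a' := by
        calc a * b' * c * (b' * b * a') = a * b' * (c * b' * b) * a' := by simp only [mul_assoc]
          _ = _ := by rw [h.right]; simp only [mul_assoc]
      rwa [e]
    · have := (T.Z_binormal a a' k.memZ_left k.memZ_right _
        (T.Z.mul_mem h.memZ_left h.memZ_left)).1
      simpa only [mul_assoc] using this
    · have e : b' * b * a' * (a * b' * b) = (b' * b) * (b' * b) := by
        calc b' * b * a' * (a * b' * b) = b' * b * (a' * a * b') * b := by simp only [mul_assoc]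
          _ = _ := by rw [k.left]; simp only [mul_assoc]
      rw [e]; exact T.Z.mul_mem h.memZ_left h.memZ_left
  refine ⟨c * b' * (a * b' * c), ?_, ⟨_, hs.mul_left h.memN_right⟩, hd⟩
  have h1 : b' * a * b' ∈ T.dual A :=
    dual_triple hA (Set.mul_mem_mul (Set.mul_mem_mul hb' ha) hb')
  have h2 := hA (Set.mul_mem_mul (Set.mul_mem_mul hc h1) hc)
  simpa only [mul_assoc] using h2

theorem up_dual_subset {A : Set S} (hA : A * T.dual A * A ⊆ A) : T.up (T.dual A) ⊆ T.dual A := by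
  rintro a' ⟨b', ⟨c, hc, b, h⟩, a, k⟩
  obtain ⟨p, hp, ⟨s, h1⟩, h2⟩ := exists_dom_dom hA hc h k
  exact ⟨p, hp, a, h1.trans h2⟩

theorem dual_dual_eq {A : Set S} (hA : A * T.dual A * A ⊆ A) :
    T.dual (T.dual A) = T.up (T.up A) := by
  refine Set.Subset.antisymm ?_ (up_up_subset_dual_dual A)
  rintro a ⟨b', ⟨c, hc, b, h⟩, a', k⟩
  obtain ⟨p, hp, h1, h2⟩ := exists_dom_dom hA hc h k
  exact ⟨_, ⟨p, hp, h1⟩, a', h2⟩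

theorem IsCoset.dual {C : Set S} (hC : T.IsCoset C) : T.IsCoset (T.dual C) := by
  refine ⟨dual_triple hC.1, Set.Subset.antisymm ?_ (up_dual_subset hC.1)⟩
  conv_lhs => rw [hC.2]
  exact dual_up_subset C

theorem isCoset_up {A : Set S} (hA : A * T.dual A * A ⊆ A) (hu : A ⊆ T.up A) :
    T.IsCoset (T.up A) := by
  have e : T.up (T.up A) = T.up A := Set.Subset.antisymm (up_up_subset A) (up_mono hu)
  refine ⟨?_, e.symm⟩
  have e' := dual_dual_eq hA
  rw [e] at e'
  rw [← e']
  exact dual_triple (dual_triple hA)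

theorem IsCoset.up_mul {B C : Set S} (hB : T.IsCoset B) (hC : T.IsCoset C)
    (h : T.up (T.dual B * B) = T.up (C * T.dual C)) : T.IsCoset (T.up (B * C)) := by
  have hBd : T.dual B * B ⊆ T.up (T.dual B * B) := by
    exact (Set.mul_subset_mul hB.dual.2.subset hB.2.subset).trans (up_mul_up _ _)
  have h1 : T.dual B * B * C ⊆ C := by
    refine (Set.mul_subset_mul_right (hBd.trans h.subset)).trans ?_
    refine subset_trans (Set.mul_subset_mul_left hC.2.subset) ?_
    refine (up_mul_up _ _).trans ((up_mono hC.1).trans hC.2.symm.subset)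
  have hdd : B ⊆ T.dual (T.dual B) := by
    rw [dual_dual_eq hB.1, ← hB.2]; exact hB.2.subset
  have h2 : T.dual (B * C) * B ⊆ T.dual C := by
    refine (Set.mul_subset_mul_left hdd).trans ((dual_mul_dual _ _).trans (dual_mono ?_))
    rwa [← mul_assoc]
  refine isCoset_up ?_ ?_
  · calc B * C * T.dual (B * C) * (B * C) = B * (C * (T.dual (B * C) * B) * C) := by
          simp only [mul_assoc]
      _ ⊆ B * (C * T.dual C * C) :=
          Set.mul_subset_mul_left (Set.mul_subset_mul_right (Set.mul_subset_mul_left h2))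
      _ ⊆ B * C := Set.mul_subset_mul_left hC.1
  · exact (Set.mul_subset_mul hB.2.subset hC.2.subset).trans (up_mul_up _ _)

namespace Coset

theorem mul_mem_up (B C : T.Coset) {b c : S} (hb : b ∈ B.carrier) (hc : c ∈ C.carrier) :
    b * c ∈ T.up (B.carrier * C.carrier) := by
  rw [B.isCoset.2] at hb
  rw [C.isCoset.2] at hc
  exact up_mul_up _ _ (Set.mul_mem_mul hb hc)

theorem exists_domVia (C : T.Coset) {c : S} (hc : c ∈ C.carrier) :
    ∃ c', ∃ d ∈ C.carrier, T.DomVia d c' c := by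
  rw [C.isCoset.2] at hc
  obtain ⟨d, hd, c', h⟩ := hc
  exact ⟨c', d, hd, h⟩

/-- The inverse `C^*` in the coset groupoid. -/
def inv (C : T.Coset) : T.Coset where
  carrier := T.dual C.carrier
  isCoset := C.isCoset.dual
  nonempty := by
    obtain ⟨c, hc⟩ := C.nonempty
    obtain ⟨c', d, hd, h⟩ := C.exists_domVia hc
    exact ⟨c', d, hd, c, h⟩

/-- The product of `B` and `C` is defined: `s(B) = (B^* B)^<` equals `r(C) = (C C^*)^<`. -/
def Composable (B C : T.Coset) : Prop :=
  T.up (T.dual B.carrier * B.carrier) = T.up (C.carrier * T.dual C.carrier)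

/-- The product `(BC)^<` in the coset groupoid, for `s(B) = r(C)`. -/
def mul (B C : T.Coset) (h : Composable B C) : T.Coset where
  carrier := T.up (B.carrier * C.carrier)
  isCoset := B.isCoset.up_mul C.isCoset h
  nonempty := by
    obtain ⟨b, hb⟩ := B.nonempty
    obtain ⟨c, hc⟩ := C.nonempty
    exact ⟨b * c, B.mul_mem_up C hb hc⟩

open Classical in
/-- The coset groupoid. -/
noncomputable instance : GroupoidOps T.Coset where
  inv := inv
  mul B C := if h : Composable B C then mul B C h else B

/-- The canonical topology on the coset groupoid, with subbasis the sets `{C | a ∈ C}`. -/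
instance : TopologicalSpace T.Coset :=
  .generateFrom (Set.range fun a : S => {C : T.Coset | a ∈ C.carrier})

end Coset

variable (T)

/-- The total space of the coset bundle: pairs `[c, C]` consisting of a non-empty coset `C` and the
class in `C`, with respect to `∼_C`, of some `c ∈ C`. -/
@[ext]
structure CosetBundle where
  base : T.Coset
  cls : Set S
  exists_rep : ∃ c ∈ base.carrier, cls = {x | T.Equiv base.carrier x c}

variable {T}

namespace CosetBundle

/-- The element `[c, C]`. -/
def mk' (C : T.Coset) (c : S) (hc : c ∈ C.carrier) : T.CosetBundle where
  base := C
  cls := {x | T.Equiv C.carrier x c}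
  exists_rep := ⟨c, hc, rfl⟩

/-- A representative `c` of `x = [c, C]`. -/
noncomputable def rep (x : T.CosetBundle) : S := x.exists_rep.choose

theorem rep_mem (x : T.CosetBundle) : x.rep ∈ x.base.carrier := x.exists_rep.choose_spec.1

/-- The inverse `[c, C]⁻¹ = [c', C^*]`, for any `c'` with `d <_{c'} c` for some `d ∈ C`. -/
noncomputable def inv (x : T.CosetBundle) : T.CosetBundle :=
  mk' x.base.inv (x.base.exists_domVia x.rep_mem).choose
    (by
      obtain ⟨d, hd, h⟩ := (x.base.exists_domVia x.rep_mem).choose_spec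
      exact ⟨d, hd, _, h⟩)

/-- The product `[a, A][b, B] = [ab, (AB)^<]`, for `s(A) = r(B)`. -/
noncomputable def mul (x y : T.CosetBundle) (h : Coset.Composable x.base y.base) :
    T.CosetBundle :=
  mk' (Coset.mul x.base y.base h) (x.rep * y.rep) (Coset.mul_mem_up _ _ x.rep_mem y.rep_mem)

open Classical in
/-- The groupoid structure of the total space of the coset bundle. -/
noncomputable instance : GroupoidOps T.CosetBundle where
  inv := inv
  mul x y := if h : Coset.Composable x.base y.base then mul x y h else x

/-- The canonical topology on the total space of the coset bundle: its subbasis consists of the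
sets `{[s, C] | s ∈ C}` and the sets `{[c, C] | c, s ∈ C}`, for `s ∈ S`. -/
instance : TopologicalSpace T.CosetBundle :=
  .generateFrom
    ((Set.range fun s : S => {x : T.CosetBundle | ∃ C, ∃ hs : s ∈ C.carrier, x = mk' C s hs}) ∪
      Set.range fun s : S => {x : T.CosetBundle | s ∈ x.base.carrier})

end CosetBundle

variable (T)

/-- The coset bundle: the projection `[c, C] ↦ C`. -/
def cosetBundle : T.CosetBundle → T.Coset := CosetBundle.base

/-- The coset bundle representation: `a` is sent to the partial function that is defined at the
cosets `C` containing `a`, with value `[a, C]`. -/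
def cosetBundleRep (a : S) : T.Coset →. T.CosetBundle :=
  fun C => ⟨a ∈ C.carrier, fun h => CosetBundle.mk' C a h⟩

/-! ### Representations -/

/-- An étale representation of `(S, N, Z)` on an étale groupoid `G`: a semigroup homomorphism to
the open slices of `G` that covers `G`, maps `N` to sets of units and is locally round. -/
structure IsEtaleRep {G : Type*} [GroupoidOps G] [TopologicalSpace G] (θ : S → Set G) : Prop where
  etale : IsEtaleGroupoid G
  isOpen : ∀ a, IsOpen (θ a)
  isSlice : ∀ a, IsSlice (θ a)
  map_mul : ∀ a b, θ (a * b) = setMul (θ a) (θ b)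
  cover : ∀ g, ∃ a, g ∈ θ a
  map_N : ∀ n ∈ T.N, θ n ⊆ units G
  locally_round : ∀ g a, g ∈ θ a → ∃ b, T.Dominated b a ∧ g ∈ θ b

/-- A bundle representation of `(S, N, Z)` on a groupoid bundle `π`: a semigroup homomorphism to
the slice-sections of `π` whose domains form an étale representation. -/
structure IsBundleRep {F G : Type*} [GroupoidOps F] [GroupoidOps G]
    [TopologicalSpace F] [TopologicalSpace G] (π : F → G) (θ : S → (G →. F)) : Prop where
  bundle : IsGroupoidBundle π
  isSliceSection : ∀ a, IsSliceSection π (θ a)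
  map_mul : ∀ a b, IsSectionProduct (θ a) (θ b) (θ (a * b))
  etaleRep : T.IsEtaleRep fun a => (θ a).Dom

end Cosets

/-- `(S, N, Z)` has a faithful (i.e. injective) bundle representation. The bundle may live in any
universe that is at least as large as that of `S`. -/
def HasFaithfulBundleRep {S : Type u} [Semigroup S] (T : StructuredSemigroup S) : Prop :=
  ∃ (F G : Type (max u v)) (_ : GroupoidOps F) (_ : GroupoidOps G)
    (_ : TopologicalSpace F) (_ : TopologicalSpace G) (π : F → G) (θ : S → (G →. F)),
    T.IsBundleRep π θ ∧ Function.Injective θ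

end StructuredSemigroup

/-! An arrow `g` of a represented groupoid leaves the trace `{a | g ∈ θ a}` in `S`, and this trace
is a coset (`IsEtaleRep.isCoset_setOf_mem`). Cosets are therefore candidate arrows, and a `∼`-class
in a coset is a candidate value of a section there. The coset bundle collects all candidates.

It separates at least as much as any other bundle. If `sat = sbt` with `s`, `t` in the dual of the
trace of `g`, then `θ s` and `θ t` are defined at `g⁻¹`, and cancelling their values gives `θ a` and
`θ b` the same value at `g` (`IsBundleRep.eq_of_equiv`). So elements that are equivalent in every
coset meeting `{a, b}` have the same image under every bundle representation: this is 1 → 3. Since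
`[a, C] = [b, C]` exactly when `a ∼ b` in `C` (`CosetBundle.mk'_eq_iff`), condition 3 says that
distinct elements have distinct coset sections, which is 2. For 2 → 1 the coset bundle itself
serves, up to a change of universe.

The main work is that `a ↦ ã` is a bundle representation at all. The groupoid laws for cosets reduce
to identities of set products, because up-closures may be dropped inside products and `C C^* C`
generates `C`. A coset is determined by one element and its source (`Coset.eq_of_mem_of_src_eq`), so
the basic open sets are slices; the cosets `(aV)^<` of `Coset.translate` give continuous local
inverses of the source map, whence étaleness. Symmetry of `Z` serves only to factor a coset
containing `ab` into cosets containing `a` and `b` (`Coset.exists_mul_eq_of_mul_mem`). In the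
fibres, `equiv_iff` replaces the two-sided relation by `za = zb` with one `z ∈ Z` in the range unit.
This makes `∼` compatible with products, and since containing `z` is an open condition, it also
yields continuity. -/

namespace StructuredSemigroup

/-! ### Calculus of up-closures, duals and products of cosets -/

section CosetAlgebra

variable {S : Type*} [Semigroup S] {T : StructuredSemigroup S}

/-- Left-right mirror image of `DomVia.switch`. -/
theorem DomVia.switch_right {a b c' c : S} (h : b * a ∈ T.N) (k : T.DomVia b c' c) :
    T.DomVia (c' * b * a) c c' := by
  have e : c * (c' * b * a) = b * a := by rw [← mul_assoc, ← mul_assoc, k.left]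
  refine .of_left ?_ ?_ k.memZ_left k.memZ_right
  · rw [mul_assoc c', e, mul_assoc]
  · rwa [e]

theorem DomVia.mul_right {a b' b n : S} (hn : n ∈ T.N) (h : T.DomVia a b' b) :
    T.DomVia (a * n) b' b := by
  refine .of_left ?_ ?_ h.memZ_right h.memZ_left
  · rw [← mul_assoc, h.left]
  · rw [← mul_assoc]; exact T.N.mul_mem h.memN_left hn

theorem DomVia.mem_N {a s n : S} (h : T.DomVia a s n) (hn : n ∈ T.N) : a ∈ T.N := by
  rw [← h.right]; exact T.N.mul_mem h.memN_right hn

/-- If `n ∈ N` dominates `m` via `s`, then the central element `sn` dominates `m` as well. -/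
theorem DomVia.dominated_central {m s n : S} (h : T.DomVia m s n) (hn : n ∈ T.N) :
    T.Dominated m (s * n) := by
  have e : m * (s * n) = m := by rw [← mul_assoc, h.right]
  refine ⟨s * n, .of_right ?_ ?_ ?_ ?_⟩
  · rw [e, e]
  · rw [e]; exact h.mem_N hn
  · exact T.Z.mul_mem h.memZ_left h.memZ_left
  · exact T.Z.mul_mem h.memZ_left h.memZ_left

/-- Domination is transitive and multiplicative, so for sets contained in their own up-closure an
inner closure is absorbed by the outer one. This is what turns identities of cosets into identities
of plain set products. -/
theorem up_up_mul {A B : Set S} (hA : A ⊆ T.up A) (hB : B ⊆ T.up B) :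
    T.up (T.up A * B) = T.up (A * B) := by
  refine Set.Subset.antisymm ?_ (up_mono (Set.mul_subset_mul_right hA))
  exact (up_mono ((Set.mul_subset_mul_left hB).trans (up_mul_up _ _))).trans (up_up_subset _)

theorem up_mul_up_right {A B : Set S} (hA : A ⊆ T.up A) (hB : B ⊆ T.up B) :
    T.up (A * T.up B) = T.up (A * B) := by
  refine Set.Subset.antisymm ?_ (up_mono (Set.mul_subset_mul_left hB))
  exact (up_mono ((Set.mul_subset_mul_right hA).trans (up_mul_up _ _))).trans (up_up_subset _)

theorem mul_subset_up_mul {A B : Set S} (hA : A ⊆ T.up A) (hB : B ⊆ T.up B) :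
    A * B ⊆ T.up (A * B) :=
  (Set.mul_subset_mul hA hB).trans (up_mul_up _ _)

namespace IsCoset

variable {B C : Set S}

theorem subset_up (hC : T.IsCoset C) : C ⊆ T.up C := hC.2.subset

theorem dual_dual (hC : T.IsCoset C) : T.dual (T.dual C) = C := by
  rw [dual_dual_eq hC.1, ← hC.2, ← hC.2]

theorem mem_of_dominated (hC : T.IsCoset C) {a b : S} (ha : a ∈ C) (h : T.Dominated a b) :
    b ∈ C := by
  rw [hC.2]; exact ⟨a, ha, h⟩

theorem exists_domVia (hC : T.IsCoset C) {c : S} (hc : c ∈ C) :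
    ∃ d ∈ C, ∃ c' ∈ T.dual C, T.DomVia d c' c := by
  rw [hC.2] at hc
  obtain ⟨d, hd, c', h⟩ := hc
  exact ⟨d, hd, c', ⟨d, hd, c, h⟩, h⟩

theorem mul_mem (hC : T.IsCoset C) {a s c : S} (ha : a ∈ C) (hs : s ∈ T.dual C) (hc : c ∈ C) :
    a * s * c ∈ C :=
  hC.1 (Set.mul_mem_mul (Set.mul_mem_mul ha hs) hc)

theorem dual_mul_mem (hC : T.IsCoset C) {a s c : S} (ha : a ∈ T.dual C) (hs : s ∈ C)
    (hc : c ∈ T.dual C) : a * s * c ∈ T.dual C :=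
  hC.dual.mul_mem ha (by rwa [hC.dual_dual]) hc

/-- If `d <_{c'} c` in `C` then `d = d c' c` is already a triple product, and it dominates its way
up to `c`. This is the coset form of `g g⁻¹ g = g`. -/
theorem up_triple (hC : T.IsCoset C) : T.up (C * T.dual C * C) = C := by
  refine Set.Subset.antisymm ((up_mono hC.1).trans hC.2.symm.subset) fun c hc => ?_
  obtain ⟨d, hd, c', hc', h⟩ := hC.exists_domVia hc
  exact ⟨d, ⟨d * c', Set.mul_mem_mul hd hc', c, hc, h.right⟩, c', h⟩

/-- A coset is generated by any one of its elements and its source. -/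
theorem subset_up_singleton_mul (hC : T.IsCoset C) {c : S} (hc : c ∈ C) :
    C ⊆ T.up ({c} * (T.dual C * C)) := by
  intro d hd
  obtain ⟨c₀, -, c', hc', h⟩ := hC.exists_domVia hc
  obtain ⟨d₀, hd₀, d', -, k⟩ := hC.exists_domVia hd
  refine ⟨c * c' * d₀, ?_, d', k.mul_left (T.Z_le_N h.memZ_right)⟩
  rw [mul_assoc]
  exact Set.mul_mem_mul rfl (Set.mul_mem_mul hc' hd₀)

/-- A coset is generated by any one of its elements and its range. -/
theorem subset_up_mul_singleton (hC : T.IsCoset C) {c : S} (hc : c ∈ C) :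
    C ⊆ T.up (C * T.dual C * {c}) := by
  intro d hd
  obtain ⟨c₀, -, c', hc', h⟩ := hC.exists_domVia hc
  obtain ⟨d₀, hd₀, d', -, k⟩ := hC.exists_domVia hd
  refine ⟨d₀ * (c' * c), ?_, d', k.mul_right (T.Z_le_N h.memZ_left)⟩
  rw [← mul_assoc]
  exact Set.mul_mem_mul (Set.mul_mem_mul hd₀ hc') rfl

theorem dual_mul_subset (hB : T.IsCoset B) (h : T.dual B * B * C ⊆ C) :
    T.dual (B * C) * B ⊆ T.dual C := by
  have hdd : B ⊆ T.dual (T.dual B) := hB.dual_dual.symm.subset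
  refine (Set.mul_subset_mul_left hdd).trans ((dual_mul_dual _ _).trans (dual_mono ?_))
  rwa [← mul_assoc]

theorem src_mul_subset (hB : T.IsCoset B) (hC : T.IsCoset C)
    (h : T.up (T.dual B * B) = T.up (C * T.dual C)) : T.dual B * B * C ⊆ C := by
  refine (Set.mul_subset_mul_right ((mul_subset_up_mul hB.dual.subset_up
    hB.subset_up).trans h.subset)).trans ?_
  refine (Set.mul_subset_mul_left hC.subset_up).trans ?_
  exact (up_mul_up _ _).trans hC.up_triple.subset

theorem dual_up_mul (hB : T.IsCoset B) (hC : T.IsCoset C)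
    (h : T.up (T.dual B * B) = T.up (C * T.dual C)) :
    T.dual (T.up (B * C)) = T.up (T.dual C * T.dual B) := by
  refine Set.Subset.antisymm ?_ ?_
  · refine (dual_up_subset _).trans (subset_trans (up_mono ?_) (up_up_subset _))
    rintro s ⟨_, ⟨b, hb, c, hc, rfl⟩, x, hx⟩
    obtain ⟨b₀, hb₀, b', hb', kb⟩ := hB.exists_domVia hb
    obtain ⟨c₀, hc₀, c', hc', kc⟩ := hC.exists_domVia hc
    have hsb : s * b ∈ T.dual C := hB.dual_mul_subset (hB.src_mul_subset hC h)
      (Set.mul_mem_mul ⟨b * c, Set.mul_mem_mul hb hc, x, hx⟩ hb)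
    -- Regrouped as `((s b) c c') b'`, this lies in `C^* B^*`, because `s b ∈ C^*`; as `s (bc)
    -- (c'b')` it is dominated by `s`.
    refine ⟨s * (b * c) * (c' * b'), ⟨_, hC.dual_mul_mem hsb hc hc', b', hb', ?_⟩, x,
      hx.switch_right (T.Z_le_N (kb.mul kc).memZ_right)⟩
    simp only [mul_assoc]
  · rw [(hB.up_mul hC h).dual.2]
    exact up_mono ((dual_mul_dual _ _).trans
      (dual_mono (mul_subset_up_mul hB.subset_up hC.subset_up)))

theorem dual_up_dual_mul (hC : T.IsCoset C) :
    T.dual (T.up (T.dual C * C)) = T.up (T.dual C * C) := by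
  rw [hC.dual.dual_up_mul hC (by rw [hC.dual_dual]), hC.dual_dual]

theorem up_dual_mul_mul_up (hC : T.IsCoset C) :
    T.up (T.up (T.dual C * C) * T.up (T.dual C * C)) = T.up (T.dual C * C) := by
  have h := mul_subset_up_mul hC.dual.subset_up hC.subset_up
  have h3 := hC.dual.up_triple
  rw [hC.dual_dual] at h3
  rw [up_up_mul h (up_mono h), up_mul_up_right h h, ← mul_assoc,
    ← up_up_mul (mul_subset_up_mul h hC.dual.subset_up) hC.subset_up, h3]

end IsCoset

/-! ### Groupoid laws for cosets -/

namespace Coset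

variable {B C : T.Coset}

theorem inv_carrier (C : T.Coset) : (GroupoidOps.inv C).carrier = T.dual C.carrier := rfl

theorem mul_carrier_of (h : Composable B C) :
    (GroupoidOps.mul B C).carrier = T.up (B.carrier * C.carrier) := by
  have e : GroupoidOps.mul B C = Coset.mul B C h := dif_pos h
  rw [e]; rfl

theorem src_carrier (C : T.Coset) : (src C).carrier = T.up (T.dual C.carrier * C.carrier) :=
  mul_carrier_of (show T.up _ = T.up _ by rw [inv_carrier, C.isCoset.dual_dual])

theorem rng_carrier (C : T.Coset) : (rng C).carrier = T.up (C.carrier * T.dual C.carrier) :=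
  mul_carrier_of (show T.up _ = T.up _ by rw [inv_carrier, C.isCoset.dual_dual])

theorem composable_iff : GroupoidOps.Composable B C ↔ Composable B C := by
  unfold GroupoidOps.Composable Composable
  rw [Coset.ext_iff, src_carrier, rng_carrier]

theorem mul_carrier (h : GroupoidOps.Composable B C) :
    (GroupoidOps.mul B C).carrier = T.up (B.carrier * C.carrier) :=
  mul_carrier_of (composable_iff.1 h)

theorem inv_inv (C : T.Coset) : GroupoidOps.inv (GroupoidOps.inv C) = C :=
  Coset.ext C.isCoset.dual_dual

theorem src_inv (C : T.Coset) : src (GroupoidOps.inv C) = rng C := by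
  unfold src rng; rw [inv_inv]

theorem rng_inv (C : T.Coset) : rng (GroupoidOps.inv C) = src C := by
  unfold src rng; rw [inv_inv]

theorem inv_src (C : T.Coset) : GroupoidOps.inv (src C) = src C := by
  ext1; rw [inv_carrier, src_carrier, C.isCoset.dual_up_dual_mul]

theorem src_src (C : T.Coset) : src (src C) = src C := by
  ext1
  rw [src_carrier (src C), ← inv_carrier, inv_src, src_carrier, C.isCoset.up_dual_mul_mul_up]

theorem rng_src (C : T.Coset) : rng (src C) = src C := by
  rw [← src_inv, inv_src, src_src]

theorem src_rng (C : T.Coset) : src (rng C) = rng C := by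
  rw [← src_inv, src_src]

theorem rng_rng (C : T.Coset) : rng (rng C) = rng C := by
  rw [← src_inv C, rng_src]

theorem inv_mul (h : GroupoidOps.Composable B C) :
    GroupoidOps.inv (GroupoidOps.mul B C) =
      GroupoidOps.mul (GroupoidOps.inv C) (GroupoidOps.inv B) := by
  have h' : GroupoidOps.Composable (GroupoidOps.inv C) (GroupoidOps.inv B) := by
    unfold GroupoidOps.Composable; rw [src_inv, rng_inv]; exact h.symm
  ext1
  rw [mul_carrier h', inv_carrier, mul_carrier h,
    B.isCoset.dual_up_mul C.isCoset (composable_iff.1 h)]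
  rfl

theorem mul_src (C : T.Coset) : GroupoidOps.mul C (src C) = C := by
  have h : GroupoidOps.Composable C (src C) := (rng_src C).symm
  ext1
  rw [mul_carrier h, src_carrier, up_mul_up_right C.isCoset.subset_up
    (mul_subset_up_mul C.isCoset.dual.subset_up C.isCoset.subset_up), ← mul_assoc,
    C.isCoset.up_triple]

theorem rng_mul (C : T.Coset) : GroupoidOps.mul (rng C) C = C := by
  have h : GroupoidOps.Composable (rng C) C := src_rng C
  ext1
  rw [mul_carrier h, rng_carrier, up_up_mul
    (mul_subset_up_mul C.isCoset.subset_up C.isCoset.dual.subset_up) C.isCoset.subset_up,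
    C.isCoset.up_triple]

theorem src_mul (h : GroupoidOps.Composable B C) : src (GroupoidOps.mul B C) = src C := by
  have hb := B.isCoset.subset_up
  have hb' := B.isCoset.dual.subset_up
  have hc := C.isCoset.subset_up
  have hc' := C.isCoset.dual.subset_up
  have h3 := C.isCoset.dual.up_triple
  rw [C.isCoset.dual_dual] at h3
  ext1
  rw [src_carrier, ← inv_carrier, inv_mul h, mul_carrier h, mul_carrier_of, inv_carrier,
    inv_carrier, src_carrier]
  · have hbb := mul_subset_up_mul hb' hb
    rw [up_up_mul (mul_subset_up_mul hc' hb') (up_mono (mul_subset_up_mul hb hc)),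
      up_mul_up_right (mul_subset_up_mul hc' hb') (mul_subset_up_mul hb hc)]
    -- The inner source of `B` is exchanged for the range of `C`, and then `C^* C C^*` collapses to
    -- `C^*`.
    calc T.up (T.dual C.carrier * T.dual B.carrier * (B.carrier * C.carrier))
        = T.up (T.dual C.carrier * (T.dual B.carrier * B.carrier) * C.carrier) := by
          simp only [mul_assoc]
      _ = T.up (T.up (T.dual C.carrier * T.up (T.dual B.carrier * B.carrier)) * C.carrier) := by
          rw [up_mul_up_right hc' hbb, up_up_mul (mul_subset_up_mul hc' hbb) hc]
      _ = T.up (T.dual C.carrier * C.carrier) := by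
          rw [composable_iff.1 h, up_mul_up_right hc' (mul_subset_up_mul hc hc'), ← mul_assoc,
            h3]
  · apply composable_iff.1
    unfold GroupoidOps.Composable; rw [src_inv, rng_inv]; exact h.symm

theorem composable_inv (h : GroupoidOps.Composable B C) :
    GroupoidOps.Composable (GroupoidOps.inv C) (GroupoidOps.inv B) := by
  unfold GroupoidOps.Composable; rw [src_inv, rng_inv]; exact h.symm

theorem rng_mul_eq (h : GroupoidOps.Composable B C) : rng (GroupoidOps.mul B C) = rng B := by
  rw [← src_inv, inv_mul h, src_mul (composable_inv h), src_inv]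

theorem mul_assoc' {A : T.Coset} (h : GroupoidOps.Composable A B)
    (k : GroupoidOps.Composable B C) :
    GroupoidOps.mul (GroupoidOps.mul A B) C = GroupoidOps.mul A (GroupoidOps.mul B C) := by
  have ha := A.isCoset.subset_up
  have hb := B.isCoset.subset_up
  have hc := C.isCoset.subset_up
  have h1 : GroupoidOps.Composable (GroupoidOps.mul A B) C := (src_mul h).trans k
  have h2 : GroupoidOps.Composable A (GroupoidOps.mul B C) := h.trans (rng_mul_eq k).symm
  ext1
  rw [mul_carrier h1, mul_carrier h2, mul_carrier h, mul_carrier k,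
    up_up_mul (mul_subset_up_mul ha hb) hc, up_mul_up_right ha (mul_subset_up_mul hb hc),
    mul_assoc]

theorem isGroupoid (T : StructuredSemigroup S) : IsGroupoid T.Coset where
  inv_inv := inv_inv
  mul_src := mul_src
  rng_mul := rng_mul
  src_mul _ _ := src_mul
  rng_mul_eq _ _ := rng_mul_eq
  mul_assoc _ _ _ := mul_assoc'

end Coset

end CosetAlgebra

end StructuredSemigroup

namespace StructuredSemigroup

namespace Coset

/-! ### The coset groupoid is étale, and its basic open sets are slices -/

section CosetTopology

variable {S : Type*} [Semigroup S] {T : StructuredSemigroup S} {B C V : T.Coset}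

theorem isOpen_mem (T : StructuredSemigroup S) (a : S) : IsOpen {C : T.Coset | a ∈ C.carrier} :=
  .basic _ ⟨a, rfl⟩

theorem isOpen_exists_mem (T : StructuredSemigroup S) (p : S → Prop) :
    IsOpen {C : T.Coset | ∃ a ∈ C.carrier, p a} := by
  refine isOpen_iff_mem_nhds.2 fun C ⟨a, ha, hp⟩ => ?_
  exact Filter.mem_of_superset ((isOpen_mem T a).mem_nhds ha) fun D hD => ⟨a, hD, hp⟩

theorem continuous_inv (T : StructuredSemigroup S) :
    Continuous (GroupoidOps.inv : T.Coset → T.Coset) := by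
  refine continuous_generateFrom_iff.2 ?_
  rintro _ ⟨a, rfl⟩
  exact isOpen_exists_mem T fun c => ∃ b, T.DomVia c a b

theorem continuous_mul (T : StructuredSemigroup S) :
    Continuous (fun p : {p : T.Coset × T.Coset // GroupoidOps.Composable p.1 p.2} =>
      GroupoidOps.mul p.1.1 p.1.2) := by
  refine continuous_generateFrom_iff.2 ?_
  rintro _ ⟨a, rfl⟩
  refine isOpen_iff_mem_nhds.2 fun p hp => ?_
  change a ∈ (GroupoidOps.mul p.1.1 p.1.2).carrier at hp
  rw [mul_carrier p.2] at hp
  obtain ⟨_, ⟨b, hb, c, hc, rfl⟩, h⟩ := hp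
  have h1 : IsOpen {q : {p : T.Coset × T.Coset // GroupoidOps.Composable p.1 p.2} |
      b ∈ q.1.1.carrier ∧ c ∈ q.1.2.carrier} :=
    ((isOpen_mem T b).preimage (continuous_fst.comp continuous_subtype_val)).inter
      ((isOpen_mem T c).preimage (continuous_snd.comp continuous_subtype_val))
  refine Filter.mem_of_superset (h1.mem_nhds ⟨hb, hc⟩) fun q hq => ?_
  change a ∈ (GroupoidOps.mul q.1.1 q.1.2).carrier
  rw [mul_carrier q.2]
  exact ⟨_, Set.mul_mem_mul hq.1 hq.2, h⟩

theorem isTopologicalGroupoid (T : StructuredSemigroup S) : IsTopologicalGroupoid T.Coset where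
  __ := isGroupoid T
  continuous_inv := continuous_inv T
  continuous_mul := continuous_mul T

theorem up_mul_carrier_src (C : T.Coset) : T.up (C.carrier * (src C).carrier) = C.carrier := by
  rw [← mul_carrier (show GroupoidOps.Composable C (src C) from (rng_src C).symm), mul_src]

theorem up_carrier_rng_mul (C : T.Coset) : T.up ((rng C).carrier * C.carrier) = C.carrier := by
  rw [← mul_carrier (show GroupoidOps.Composable (rng C) C from src_rng C), rng_mul]

/-- Both cosets are generated by `c` together with their common source. -/
theorem eq_of_mem_of_src_eq {c : S} (hB : c ∈ B.carrier) (hC : c ∈ C.carrier)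
    (h : src B = src C) : B = C := by
  have key : ∀ {B C : T.Coset}, c ∈ B.carrier → c ∈ C.carrier → src B = src C →
      B.carrier ⊆ C.carrier := by
    intro B C hB hC h
    refine (B.isCoset.subset_up_singleton_mul hB).trans ?_
    rw [← up_mul_carrier_src C, ← h, src_carrier]
    refine up_mono (Set.mul_subset_mul (Set.singleton_subset_iff.2 hC) ?_)
    exact mul_subset_up_mul B.isCoset.dual.subset_up B.isCoset.subset_up
  exact Coset.ext ((key hB hC h).antisymm (key hC hB h.symm))

theorem eq_of_mem_of_rng_eq {c : S} (hB : c ∈ B.carrier) (hC : c ∈ C.carrier)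
    (h : rng B = rng C) : B = C := by
  have key : ∀ {B C : T.Coset}, c ∈ B.carrier → c ∈ C.carrier → rng B = rng C →
      B.carrier ⊆ C.carrier := by
    intro B C hB hC h
    refine (B.isCoset.subset_up_mul_singleton hB).trans ?_
    rw [← up_carrier_rng_mul C, ← h, rng_carrier]
    refine up_mono (Set.mul_subset_mul ?_ (Set.singleton_subset_iff.2 hC))
    exact mul_subset_up_mul B.isCoset.subset_up B.isCoset.dual.subset_up
  exact Coset.ext ((key hB hC h).antisymm (key hC hB h.symm))

theorem isSlice_mem (T : StructuredSemigroup S) (a : S) :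
    IsSlice {C : T.Coset | a ∈ C.carrier} :=
  ⟨fun _ hB _ hC h => eq_of_mem_of_src_eq hB hC h, fun _ hB _ hC h => eq_of_mem_of_rng_eq hB hC h⟩

theorem mul_mem_mul (h : GroupoidOps.Composable B C) {b c : S} (hb : b ∈ B.carrier)
    (hc : c ∈ C.carrier) : b * c ∈ (GroupoidOps.mul B C).carrier := by
  rw [mul_carrier h]
  exact mul_subset_up_mul B.isCoset.subset_up C.isCoset.subset_up (Set.mul_mem_mul hb hc)

theorem dual_mul_mem_src {s c : S} (hs : s ∈ T.dual C.carrier) (hc : c ∈ C.carrier) :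
    s * c ∈ (src C).carrier := by
  rw [src_carrier]
  exact mul_subset_up_mul C.isCoset.dual.subset_up C.isCoset.subset_up (Set.mul_mem_mul hs hc)

theorem mul_dual_mem_rng {s c : S} (hs : s ∈ T.dual C.carrier) (hc : c ∈ C.carrier) :
    c * s ∈ (rng C).carrier := by
  rw [rng_carrier]
  exact mul_subset_up_mul C.isCoset.subset_up C.isCoset.dual.subset_up (Set.mul_mem_mul hc hs)

theorem mul_src_mem {c v : S} (hc : c ∈ C.carrier) (hv : v ∈ (src C).carrier) :
    c * v ∈ C.carrier := by
  have := mul_mem_mul (show GroupoidOps.Composable C (src C) from (rng_src C).symm) hc hv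
  rwa [mul_src] at this

theorem rng_mul_mem {c v : S} (hv : v ∈ (rng C).carrier) (hc : c ∈ C.carrier) :
    v * c ∈ C.carrier := by
  have := mul_mem_mul (show GroupoidOps.Composable (rng C) C from src_rng C) hv hc
  rwa [rng_mul] at this

/-- A coset that contains an element of `N` is a unit. -/
theorem src_eq_of_mem_N {n : S} (hn : n ∈ T.N) (hC : n ∈ C.carrier) : src C = C := by
  obtain ⟨m, hm, s, hs, h⟩ := C.isCoset.exists_domVia hC
  -- The element `s * n` lies in the source, and it lies in `C` because it dominates `m`; both
  -- cosets have the same source.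
  exact eq_of_mem_of_src_eq (dual_mul_mem_src hs hC)
    (C.isCoset.mem_of_dominated hm (h.dominated_central hn)) (src_src C)

section Translate

variable {a a₁ s : S}

theorem mul_mem_of_src_eq (hV : src V = V) {v w : S} (hv : v ∈ V.carrier) (hw : w ∈ V.carrier) :
    v * w ∈ V.carrier :=
  mul_src_mem hv (by rwa [hV])

theorem dual_eq_of_src_eq (hV : src V = V) : T.dual V.carrier = V.carrier := by
  have h := inv_src V
  rw [hV] at h
  exact congrArg Coset.carrier h

theorem singleton_mul_subset_up (k : T.DomVia a₁ s a) (hV : s * a₁ ∈ V.carrier) :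
    {a} * V.carrier ⊆ T.up ({a} * V.carrier) := by
  have hu := src_eq_of_mem_N k.memN_left hV
  rintro _ ⟨_, rfl, v, hv, rfl⟩
  obtain ⟨v₀, hv₀, v', hv', h⟩ := V.isCoset.exists_domVia hv
  refine ⟨a₁ * v₀, ⟨_, rfl, s * a₁ * v₀, mul_mem_of_src_eq hu hV hv₀, ?_⟩, _, k.mul h⟩
  change _ * (s * a₁ * v₀) = _
  rw [← mul_assoc, ← mul_assoc, k.left]

/-- The coset candidate `aV` has its source inside `V`: from `a ∈ {s a₁ s}^*` one gets `(aV)^* a ⊆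
(s a₁ s a V)^* = (s a₁ V)^* ⊆ V^* = V`. -/
theorem dual_singleton_mul_subset (k : T.DomVia a₁ s a) (hV : s * a₁ ∈ V.carrier) :
    T.dual ({a} * V.carrier) * ({a} * V.carrier) ⊆ V.carrier := by
  have hu := src_eq_of_mem_N k.memN_left hV
  have ha : ({a} : Set S) ⊆ T.dual {s * a₁ * s} := by
    refine Set.singleton_subset_iff.2 ⟨_, rfl, s, .of_right ?_ ?_ k.memZ_left k.memZ_right⟩
    · calc s * a₁ * s * a * s = s * (a₁ * s * a) * s := by simp only [mul_assoc]
        _ = _ := by rw [k.right]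
    · rw [mul_assoc s, mul_assoc s, k.right]; exact k.memN_left
  have h : T.dual ({a} * V.carrier) * {a} ⊆ V.carrier := by
    refine (Set.mul_subset_mul_left ha).trans ((dual_mul_dual _ _).trans ?_)
    rw [← dual_eq_of_src_eq hu]
    refine dual_mono ?_
    rw [dual_eq_of_src_eq hu]
    rintro _ ⟨_, rfl, _, ⟨c, rfl, v, hv, rfl⟩, rfl⟩
    have e : s * a₁ * s * (c * v) = s * a₁ * v := by
      calc s * a₁ * s * (c * v) = s * (a₁ * s * c) * v := by simp only [mul_assoc]
        _ = _ := by rw [k.right]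
    change s * a₁ * s * (c * v) ∈ _
    rw [e]
    exact mul_mem_of_src_eq hu hV hv
  rw [← mul_assoc]
  rintro _ ⟨x, hx, v, hv, rfl⟩
  exact mul_mem_of_src_eq hu (h hx) hv

/-- The arrow with source `V` that contains `a`, for a unit `V` with `sa₁ ∈ V` and `a₁ <ₛ a`. -/
def translate (k : T.DomVia a₁ s a) (V : T.Coset) (hV : s * a₁ ∈ V.carrier) : T.Coset where
  carrier := T.up ({a} * V.carrier)
  isCoset := by
    have hu := src_eq_of_mem_N k.memN_left hV
    refine isCoset_up ?_ (singleton_mul_subset_up k hV)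
    rw [mul_assoc, mul_assoc]
    refine Set.mul_subset_mul_left ?_
    refine (Set.mul_subset_mul_left (dual_singleton_mul_subset k hV)).trans ?_
    rintro _ ⟨v, hv, w, hw, rfl⟩
    exact mul_mem_of_src_eq hu hv hw
  nonempty := ⟨_, singleton_mul_subset_up k hV (Set.mul_mem_mul rfl hV)⟩

theorem mem_translate (k : T.DomVia a₁ s a) (hV : s * a₁ ∈ V.carrier) :
    a ∈ (translate k V hV).carrier := by
  refine ⟨a₁, ⟨a, rfl, _, hV, ?_⟩, s, k⟩
  change a * (s * a₁) = a₁
  rw [← mul_assoc, k.left]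

theorem src_translate (k : T.DomVia a₁ s a) (hV : s * a₁ ∈ V.carrier) :
    src (translate k V hV) = V := by
  have hu := src_eq_of_mem_N k.memN_left hV
  have hd := dual_eq_of_src_eq hu
  have hr := singleton_mul_subset_up k hV
  ext1
  rw [src_carrier]
  apply Set.Subset.antisymm
  · change T.up (T.dual (T.up _) * T.up _) ⊆ _
    refine (up_mono ((Set.mul_subset_mul_right (dual_up_subset _)).trans (up_mul_up _ _))).trans ?_
    refine (up_up_subset _).trans ((up_mono (dual_singleton_mul_subset k hV)).trans ?_)
    exact V.isCoset.2.symm.subset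
  -- The generator is the square of `s * a₁`, so that a product with `v w` regroups as `(s a₁ s) (a₁
  -- v w)`, with first factor in the dual of the translate and second factor in the translate.
  · refine (V.isCoset.subset_up_singleton_mul (mul_mem_of_src_eq hu hV hV)).trans (up_mono ?_)
    have hm : ∀ {v}, v ∈ V.carrier → a₁ * v ∈ T.up ({a} * V.carrier) := by
      intro v hv
      refine hr ⟨a, rfl, s * a₁ * v, mul_mem_of_src_eq hu hV hv, ?_⟩
      change a * (s * a₁ * v) = _
      rw [← mul_assoc a, ← mul_assoc a, k.left]
    rw [hd]
    rintro _ ⟨_, rfl, _, ⟨v, hv, w, hw, rfl⟩, rfl⟩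
    refine ⟨s * a₁ * s, ?_, a₁ * (v * w), ?_, ?_⟩
    · rw [← hd] at hV
      obtain ⟨v₀, hv₀, v₁, h⟩ := hV
      exact ⟨a₁ * v₀, hm hv₀, _, k.mul h⟩
    · exact hm (mul_mem_of_src_eq hu hv hw)
    · simp only [mul_assoc]

theorem translate_src (k : T.DomVia a₁ s a) (hs : s ∈ T.dual C.carrier) (ha₁ : a₁ ∈ C.carrier) :
    translate k (src C) (dual_mul_mem_src hs ha₁) = C :=
  eq_of_mem_of_src_eq (mem_translate k _) (C.isCoset.mem_of_dominated ha₁ ⟨s, k⟩)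
    (by rw [src_translate])

/-- Membership of `b` in `(aV)^<` is witnessed by a single `v ∈ V` with `av < b`, an open condition
on `V`. -/
theorem continuous_translate (k : T.DomVia a₁ s a) :
    Continuous fun V : {V : T.Coset | s * a₁ ∈ V.carrier} => translate k V.1 V.2 := by
  refine continuous_generateFrom_iff.2 ?_
  rintro _ ⟨b, rfl⟩
  refine Eq.subst (motive := IsOpen) (Set.ext fun V => ?_)
    ((isOpen_exists_mem T fun v => T.Dominated (a * v) b).preimage continuous_subtype_val)
  constructor
  · rintro ⟨v, hv, h⟩
    exact ⟨_, ⟨_, rfl, v, hv, rfl⟩, h⟩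
  · rintro ⟨_, ⟨_, rfl, v, hv, rfl⟩, h⟩
    exact ⟨v, hv, h⟩

end Translate

/-- Near the source of a given coset, `translate` is a continuous section of the source map passing
through that coset. -/
theorem isOpenMap_src (T : StructuredSemigroup S) : IsOpenMap (src : T.Coset → T.Coset) := by
  intro O hO
  refine isOpen_iff_mem_nhds.2 ?_
  rintro _ ⟨C, hC, rfl⟩
  obtain ⟨a, ha⟩ := C.nonempty
  obtain ⟨a₁, ha₁, s, hs, k⟩ := C.isCoset.exists_domVia ha
  have ho := (isOpen_mem T (s * a₁)).isOpenMap_subtype_val _ (hO.preimage (continuous_translate k))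
  refine Filter.mem_of_superset (ho.mem_nhds
    ⟨⟨src C, dual_mul_mem_src hs ha₁⟩, ?_, rfl⟩) ?_
  · rw [Set.mem_preimage, translate_src k hs ha₁]; exact hC
  · rintro _ ⟨V, hV, rfl⟩
    exact ⟨_, hV, src_translate k V.2⟩

theorem isEtaleGroupoid (T : StructuredSemigroup S) : IsEtaleGroupoid T.Coset where
  __ := isTopologicalGroupoid T
  isOpenMap_src := isOpenMap_src T

/-- If `Z` is symmetric then every arrow that contains a product `ab` is the product of an arrow
that contains `a` and an arrow that contains `b`. -/
theorem exists_mul_eq_of_mul_mem (hZ : IsSymmetricSubset (T.Z : Set S)) {a b : S}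
    (h : a * b ∈ C.carrier) :
    ∃ A B : T.Coset, a ∈ A.carrier ∧ b ∈ B.carrier ∧ GroupoidOps.Composable A B ∧
      GroupoidOps.mul A B = C := by
  obtain ⟨k, hk, t, ht, d⟩ := C.isCoset.exists_domVia h
  have e₁ : a * (b * (t * k)) = k := by simpa only [mul_assoc] using d.left
  have e₂ : k * (t * (a * (b * t))) = k * t := by
    have := T.Z_comm _ d.memZ_right _ d.memN_right
    rw [← mul_assoc (a * b * t) k, d.left] at this
    simpa only [mul_assoc] using this
  have e₃ : ∀ x, k * (t * (a * (b * (t * x)))) = k * (t * x) := fun x => by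
    have := congrArg (· * x) e₂
    simpa only [mul_assoc] using this
  -- Symmetry of `Z` is applied to `a · (bt) ∈ Z`. The natural candidate `ta` for an inverse of `b`
  -- need not satisfy `b(ta) ∈ Z`; its replacement `tabta` does.
  have hz : b * (t * (a * (b * (t * a)))) ∈ T.Z := by
    have : _ ∈ T.Z := hZ a (b * t) (by rw [← mul_assoc]; exact d.memZ_right)
    simpa only [mul_assoc] using this
  have hd : T.DomVia (b * (t * k)) (t * (a * (b * (t * a)))) b := by
    refine .of_left ?_ ?_ hz ?_
    · simp only [mul_assoc, e₁]
    · simp only [mul_assoc, e₁]; exact d.memN_left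
    · have := T.Z.mul_mem d.memZ_left d.memZ_left
      simpa only [mul_assoc] using this
  have he : T.DomVia (k * (t * a)) (b * (t * (a * (b * t)))) a := by
    refine .of_right ?_ ?_ ?_ ?_
    · simp only [mul_assoc, e₃]
    · simp only [mul_assoc, e₃, e₂]; exact d.memN_right
    · have := T.Z.mul_mem d.memZ_right d.memZ_right
      simpa only [mul_assoc] using this
    · simpa only [mul_assoc] using hz
  have htk : t * k ∈ (src C).carrier := dual_mul_mem_src ht hk
  have hV : t * (a * (b * (t * a))) * (b * (t * k)) ∈ (src C).carrier := by
    simpa only [mul_assoc, e₁] using htk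
  -- `B` is the arrow through `b` with the source of `C`; the left factor is then forced to be `C
  -- B⁻¹`.
  set B := translate hd (src C) hV with hB
  have hsB : src B = src C := src_translate hd hV
  have hs : t * (a * (b * (t * a))) ∈ T.dual B.carrier :=
    ⟨_, singleton_mul_subset_up hd hV (Set.mul_mem_mul rfl htk), _, hd⟩
  have hc : GroupoidOps.Composable C (GroupoidOps.inv B) := by
    unfold GroupoidOps.Composable; rw [rng_inv, hsB]
  have hc' : GroupoidOps.Composable (GroupoidOps.inv B) B := src_inv B
  refine ⟨GroupoidOps.mul C (GroupoidOps.inv B), B, ?_, mem_translate hd hV, ?_, ?_⟩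
  · refine Coset.isCoset _ |>.mem_of_dominated ?_ ⟨_, he⟩
    have := mul_mem_mul hc hk hs
    rwa [e₃] at this
  · exact (src_mul hc).trans hc'
  · rw [mul_assoc' hc hc']
    change GroupoidOps.mul C (src B) = C
    rw [hsB, mul_src]

end CosetTopology

end Coset

end StructuredSemigroup

namespace StructuredSemigroup

/-! ### Equivalence in a coset via central elements of its range -/

section Germs

variable {S : Type*} [Semigroup S] {T : StructuredSemigroup S} {A B C V : T.Coset}

namespace Coset

theorem mem_inv_of_domVia {c c' d : S} (hd : d ∈ C.carrier) (h : T.DomVia d c' c) :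
    c' ∈ (GroupoidOps.inv C).carrier :=
  ⟨d, hd, c, h⟩

/-- Elements of a unit are locally invertible: for `q <_r m` and `m <_p x` in `V`, the element `f =
mr` of `Z` absorbs `xp`, since `xp` fixes `m` on the left and commutes with `f`. -/
theorem exists_absorbs_mul_right {x : S} (hV : src V = V) (hx : x ∈ V.carrier) :
    ∃ p, ∃ f ∈ T.Z, f ∈ V.carrier ∧ f * (x * p) = f := by
  have hd := dual_eq_of_src_eq hV
  obtain ⟨m, hm, p, hp, h⟩ := V.isCoset.exists_domVia hx
  obtain ⟨q, hq, r, hr, k⟩ := V.isCoset.exists_domVia hm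
  rw [hd] at hr
  refine ⟨p, m * r, k.memZ_right, mul_mem_of_src_eq hV hm hr, ?_⟩
  rw [T.Z_comm _ h.memZ_right _ (T.Z_le_N k.memZ_right), ← mul_assoc, h.left]

theorem exists_absorbs_mul_left {x : S} (hV : src V = V) (hx : x ∈ V.carrier) :
    ∃ p, ∃ f ∈ T.Z, f ∈ V.carrier ∧ f * (p * x) = f := by
  have hd := dual_eq_of_src_eq hV
  obtain ⟨m, hm, p, hp, h⟩ := V.isCoset.exists_domVia hx
  obtain ⟨q, hq, r, hr, k⟩ := V.isCoset.exists_domVia hm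
  rw [hd] at hr
  refine ⟨p, r * m, k.memZ_left, mul_mem_of_src_eq hV hr hm, ?_⟩
  rw [mul_assoc, ← mul_assoc m, h.right]

/-- Elements that are locally trivial at the source may be absorbed on the right. -/
theorem exists_mul_eq_mul_mul {a e f : S} (ha : a ∈ C.carrier) (hf : f ∈ T.Z)
    (hfC : f ∈ (src C).carrier) (h : f * e = f) :
    ∃ z ∈ T.Z, z ∈ (rng C).carrier ∧ z * a = z * (a * e) := by
  obtain ⟨a₀, ha₀, a', ha', k⟩ := C.isCoset.exists_domVia ha
  -- Conjugation by `a` carries `f` from the source unit to the range unit; binormality keeps it in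
  -- `Z`.
  refine ⟨a * f * a', (T.Z_binormal _ _ k.memZ_right k.memZ_left _ hf).1,
    mul_dual_mem_rng ha' (mul_src_mem ha hfC), ?_⟩
  have e₁ : a * f * a' * a = a * (a' * a) * f := by
    rw [mul_assoc a (a' * a), ← T.Z_comm _ k.memZ_left _ (T.Z_le_N hf)]
    simp only [mul_assoc]
  rw [← mul_assoc, e₁, mul_assoc _ f, h]

end Coset

open Coset

/-- The factor `t` in `sat = sbt` is removed by absorption: some `tdp` acts trivially at the source,
so `a` and `b` agree with `a t d p` and `b t d p` after multiplication by elements of `Z` in the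
range. The factor `s` is completed to `cs ∈ Z`. -/
theorem equiv_iff {a b : S} : T.Equiv C.carrier a b ↔
    a ∈ C.carrier ∧ b ∈ C.carrier ∧ ∃ z ∈ T.Z, z ∈ (rng C).carrier ∧ z * a = z * b := by
  unfold Equiv
  rw [← C.isCoset.2]
  refine and_congr_right fun ha => and_congr_right fun hb => ⟨?_, ?_⟩
  · rintro ⟨s, hs, t, ht, h⟩
    obtain ⟨s₀, -, c, hc, ks⟩ := C.isCoset.dual.exists_domVia hs
    rw [C.isCoset.dual_dual] at hc
    obtain ⟨t₀, -, d, hd, kt⟩ := C.isCoset.dual.exists_domVia ht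
    rw [C.isCoset.dual_dual] at hd
    obtain ⟨p, f, hf, hfC, hp⟩ := exists_absorbs_mul_right (src_src C) (dual_mul_mem_src ht hd)
    obtain ⟨x, hx, hxC, ex⟩ := exists_mul_eq_mul_mul ha hf hfC hp
    obtain ⟨y, hy, hyC, ey⟩ := exists_mul_eq_mul_mul hb hf hfC hp
    have hxy : x * y = y * x := T.Z_comm _ hy _ (T.Z_le_N hx)
    have hxz : x * (c * s) = (c * s) * x := T.Z_comm _ ks.memZ_left _ (T.Z_le_N hx)
    have hyz : y * (c * s) = (c * s) * y := T.Z_comm _ ks.memZ_left _ (T.Z_le_N hy)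
    have hzC := mul_dual_mem_rng hs hc
    refine ⟨x * y * (c * s), T.Z.mul_mem (T.Z.mul_mem hx hy) ks.memZ_left,
      mul_mem_of_src_eq (src_rng C) (mul_mem_of_src_eq (src_rng C) hxC hyC) hzC, ?_⟩
    calc x * y * (c * s) * a = (c * s) * y * (x * a) := by
          rw [hxy, mul_assoc y, hxz, ← mul_assoc, hyz]; simp only [mul_assoc]
      _ = (c * s) * y * x * a * (t * d * p) := by rw [ex]; simp only [mul_assoc]
      _ = y * x * c * (s * a * t) * d * p := by
          rw [← hyz, mul_assoc y, ← hxz]; simp only [mul_assoc]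
      _ = (c * s) * x * (y * (b * (t * d * p))) := by
          rw [h, ← hxy, ← hxz, mul_assoc x (c * s), ← mul_assoc (c * s) y, ← hyz]
          simp only [mul_assoc]
      _ = x * y * (c * s) * b := by
          rw [← ey, ← hxz, mul_assoc x y, hyz]; simp only [mul_assoc]
  · rintro ⟨z, -, hz, h⟩
    obtain ⟨c', hc'⟩ := (Coset.inv C).nonempty
    -- Any `c' ∈ C^*` works on both sides, and `c' z` stays in `C^*` because `z` lies in the source
    -- of `C^*`.
    refine ⟨c' * z, ?_, c', hc', by rw [mul_assoc c', h, ← mul_assoc c']⟩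
    exact mul_src_mem (C := GroupoidOps.inv C) hc' (by rwa [src_inv])

namespace Equiv

variable {a a₂ b b₂ c : S}

theorem mem_left (h : T.Equiv C.carrier a b) : a ∈ C.carrier := (equiv_iff.1 h).1

theorem mem_right (h : T.Equiv C.carrier a b) : b ∈ C.carrier := (equiv_iff.1 h).2.1

theorem refl (ha : a ∈ C.carrier) : T.Equiv C.carrier a a := by
  obtain ⟨p, f, hf, hfC, -⟩ := exists_absorbs_mul_right (src_rng C) (rng C).nonempty.some_mem
  exact equiv_iff.2 ⟨ha, ha, f, hf, hfC, rfl⟩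

theorem symm (h : T.Equiv C.carrier a b) : T.Equiv C.carrier b a := by
  obtain ⟨ha, hb, z, hz, hzC, e⟩ := equiv_iff.1 h
  exact equiv_iff.2 ⟨hb, ha, z, hz, hzC, e.symm⟩

theorem trans (h : T.Equiv C.carrier a b) (k : T.Equiv C.carrier b c) :
    T.Equiv C.carrier a c := by
  obtain ⟨ha, hb, z, hz, hzC, e⟩ := equiv_iff.1 h
  obtain ⟨-, hc, y, hy, hyC, e'⟩ := equiv_iff.1 k
  refine equiv_iff.2 ⟨ha, hc, y * z, T.Z.mul_mem hy hz,
    mul_mem_of_src_eq (src_rng C) hyC hzC, ?_⟩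
  rw [mul_assoc, e, ← mul_assoc, T.Z_comm _ hz _ (T.Z_le_N hy), mul_assoc, e', ← mul_assoc]

theorem mul (hAB : GroupoidOps.Composable A B) (ha : T.Equiv A.carrier a a₂)
    (hb : T.Equiv B.carrier b b₂) :
    T.Equiv (GroupoidOps.mul A B).carrier (a * b) (a₂ * b₂) := by
  refine trans (b := a * b₂) (equiv_iff.2 ⟨mul_mem_mul hAB ha.mem_left hb.mem_left,
    mul_mem_mul hAB ha.mem_left hb.mem_right, ?_⟩) (equiv_iff.2
    ⟨mul_mem_mul hAB ha.mem_left hb.mem_right, mul_mem_mul hAB ha.mem_right hb.mem_right, ?_⟩)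
  -- The witness `z` sits between `a` and `b`: a trivial `p z` is inserted after `a`, so that `z b =
  -- z b₂` can be used.
  · obtain ⟨-, -, z, hz, hzB, e⟩ := equiv_iff.1 hb
    obtain ⟨p, f, hf, hfB, hp⟩ := exists_absorbs_mul_left (src_rng B) hzB
    rw [← (show src A = rng B from hAB)] at hfB
    obtain ⟨x, hx, hxA, ex⟩ := exists_mul_eq_mul_mul ha.mem_left hf hfB hp
    rw [rng_mul_eq hAB]
    refine ⟨x, hx, hxA, ?_⟩
    have key : ∀ d, x * (a * d) = x * a * p * (z * d) := fun d => by
      calc x * (a * d) = x * a * d := (mul_assoc _ _ _).symm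
        _ = x * (a * (p * z)) * d := by rw [ex]
        _ = x * a * p * (z * d) := by simp only [mul_assoc]
    rw [key, key, e]
  · obtain ⟨-, -, z, hz, hzA, e⟩ := equiv_iff.1 ha
    rw [rng_mul_eq hAB]
    exact ⟨z, hz, hzA, by rw [← mul_assoc, e, mul_assoc]⟩

end Equiv

/-- `e` belongs to the unit `V` and represents the identity of the fibre there. -/
def IsTrivialAt (V : T.Coset) (e : S) : Prop :=
  e ∈ V.carrier ∧ ∃ f ∈ T.Z, f ∈ V.carrier ∧ f * e = f

namespace IsTrivialAt

variable {d e c c' : S}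

theorem equiv (hV : src V = V) (hd : IsTrivialAt V d) (he : IsTrivialAt V e) :
    T.Equiv V.carrier d e := by
  obtain ⟨hd, f, hf, hfV, h⟩ := hd
  obtain ⟨he, g, hg, hgV, k⟩ := he
  refine equiv_iff.2 ⟨hd, he, g * f, T.Z.mul_mem hg hf, ?_, ?_⟩
  · rw [← hV, rng_src, hV]
    exact mul_mem_of_src_eq hV hgV hfV
  · rw [mul_assoc, h, T.Z_comm _ hf _ (T.Z_le_N hg), mul_assoc, k]

theorem of_domVia_left {d : S} (h : T.DomVia d c' c) (hd : d ∈ C.carrier) :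
    IsTrivialAt (src C) (c' * c) := by
  obtain ⟨q, hq, r, hr, k⟩ := C.isCoset.exists_domVia hd
  refine ⟨dual_mul_mem_src ⟨d, hd, c, h⟩ (C.isCoset.mem_of_dominated hd ⟨_, h⟩),
    r * d, k.memZ_left, dual_mul_mem_src hr hd, ?_⟩
  rw [mul_assoc, ← mul_assoc d, h.right]

theorem of_domVia_right {d : S} (h : T.DomVia d c' c) (hd : d ∈ C.carrier) :
    IsTrivialAt (rng C) (c * c') := by
  obtain ⟨q, hq, r, hr, k⟩ := C.isCoset.exists_domVia hd
  refine ⟨mul_dual_mem_rng ⟨d, hd, c, h⟩ (C.isCoset.mem_of_dominated hd ⟨_, h⟩),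
    d * r, k.memZ_right, mul_dual_mem_rng hr hd, ?_⟩
  rw [T.Z_comm _ h.memZ_right _ (T.Z_le_N k.memZ_right), ← mul_assoc, h.left]

theorem mul_right_equiv (he : IsTrivialAt (src C) e) (hc : c ∈ C.carrier) :
    T.Equiv C.carrier (c * e) c := by
  obtain ⟨heC, f, hf, hfC, h⟩ := he
  obtain ⟨z, hz, hzC, k⟩ := exists_mul_eq_mul_mul hc hf hfC h
  exact equiv_iff.2 ⟨mul_src_mem hc heC, hc, z, hz, hzC, k.symm⟩

theorem mul_left_equiv (he : IsTrivialAt (rng C) e) (hc : c ∈ C.carrier) :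
    T.Equiv C.carrier (e * c) c := by
  obtain ⟨heC, f, hf, hfC, h⟩ := he
  exact equiv_iff.2 ⟨rng_mul_mem heC hc, hc, f, hf, hfC, by rw [← mul_assoc, h]⟩

end IsTrivialAt

/-! ### The groupoid of germs `[c, C]` -/

namespace CosetBundle

theorem mk'_congr {a b : S} (h : B = C) (e : T.Equiv C.carrier a b) (ha : a ∈ B.carrier)
    (hb : b ∈ C.carrier) : mk' B a ha = mk' C b hb := by
  subst h
  exact CosetBundle.ext rfl (Set.ext fun x => ⟨fun hx => hx.trans e, fun hx => hx.trans e.symm⟩)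

theorem mk'_eq_iff {a b : S} (ha : a ∈ C.carrier) (hb : b ∈ C.carrier) :
    mk' C a ha = mk' C b hb ↔ T.Equiv C.carrier a b := by
  refine ⟨fun h => ?_, fun h => mk'_congr rfl h ha hb⟩
  have : a ∈ (mk' C a ha).cls := Equiv.refl ha
  rwa [h] at this

theorem mk'_rep (x : T.CosetBundle) : mk' x.base x.rep x.rep_mem = x :=
  CosetBundle.ext rfl x.exists_rep.choose_spec.2.symm

theorem exists_eq_mk' (x : T.CosetBundle) : ∃ C, ∃ c, ∃ hc, x = mk' C c hc :=
  ⟨_, _, _, (mk'_rep x).symm⟩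

theorem rep_mk'_equiv {c : S} (hc : c ∈ C.carrier) : T.Equiv C.carrier (mk' C c hc).rep c :=
  (mk'_eq_iff _ hc).1 (mk'_rep (mk' C c hc))

theorem mul_mk' {a b : S} (h : GroupoidOps.Composable A B) (ha : a ∈ A.carrier)
    (hb : b ∈ B.carrier) : GroupoidOps.mul (mk' A a ha) (mk' B b hb) =
      mk' (GroupoidOps.mul A B) (a * b) (mul_mem_mul h ha hb) := by
  have h' : Coset.Composable (mk' A a ha).base (mk' B b hb).base := composable_iff.1 h
  have e : GroupoidOps.mul (mk' A a ha) (mk' B b hb) = CosetBundle.mul _ _ h' := dif_pos h'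
  rw [e]
  refine mk'_congr (Coset.ext (mul_carrier h).symm) ?_ _ _
  exact Equiv.mul h (rep_mk'_equiv ha) (rep_mk'_equiv hb)

/-- The usual uniqueness of inverses, `r' ∼ r' c c' ∼ r' r c' ∼ c'`, since `c c'` and `r' r` are
trivial at the range and source. It makes the inverse of a germ independent of all choices. -/
theorem equiv_inv_of_domVia {r₀ r r' d c c' : S} (hr₀ : r₀ ∈ C.carrier) (k : T.DomVia r₀ r' r)
    (hd : d ∈ C.carrier) (h : T.DomVia d c' c) (hrc : T.Equiv C.carrier r c) :
    T.Equiv (GroupoidOps.inv C).carrier r' c' := by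
  have hr' := mem_inv_of_domVia hr₀ k
  have hc' := mem_inv_of_domVia hd h
  have h₁ : T.Equiv (GroupoidOps.inv C).carrier (r' * (c * c')) r' :=
    IsTrivialAt.mul_right_equiv (by rw [src_inv]; exact .of_domVia_right h hd) hr'
  have h₂ : T.Equiv (GroupoidOps.inv C).carrier (r' * r * c') c' :=
    IsTrivialAt.mul_left_equiv (by rw [rng_inv]; exact .of_domVia_left k hr₀) hc'
  have h₃ : T.Equiv (rng C).carrier (c * c') (r * c') :=
    Equiv.mul (show GroupoidOps.Composable C (GroupoidOps.inv C) from (rng_inv C).symm)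
      hrc.symm (Equiv.refl (C := GroupoidOps.inv C) hc')
  have hcomp : GroupoidOps.Composable (GroupoidOps.inv C) (rng C) := by
    unfold GroupoidOps.Composable; rw [src_inv, rng_rng]
  have h₄ := Equiv.mul hcomp (Equiv.refl hr') h₃
  rw [← src_inv, mul_src, ← mul_assoc r' r] at h₄
  exact h₁.symm.trans (h₄.trans h₂)

theorem inv_mk' {c c' d : S} (hc : c ∈ C.carrier) (hd : d ∈ C.carrier) (h : T.DomVia d c' c) :
    GroupoidOps.inv (mk' C c hc) =
      mk' (GroupoidOps.inv C) c' (mem_inv_of_domVia hd h) := by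
  have k := ((mk' C c hc).base.exists_domVia (mk' C c hc).rep_mem).choose_spec
  exact mk'_congr rfl
    (equiv_inv_of_domVia k.choose_spec.1 k.choose_spec.2 hd h (rep_mk'_equiv hc))
    (mem_inv_of_domVia k.choose_spec.1 k.choose_spec.2) (mem_inv_of_domVia hd h)

theorem base_mul {x y : T.CosetBundle} (h : GroupoidOps.Composable x.base y.base) :
    (GroupoidOps.mul x y).base = GroupoidOps.mul x.base y.base := by
  obtain ⟨A, a, ha, rfl⟩ := x.exists_eq_mk'
  obtain ⟨B, b, hb, rfl⟩ := y.exists_eq_mk'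
  have h' : GroupoidOps.Composable A B := h
  rw [mul_mk' h']; rfl

theorem base_inv (x : T.CosetBundle) : (GroupoidOps.inv x).base = GroupoidOps.inv x.base := rfl

theorem src_mk' {c e : S} (hc : c ∈ C.carrier) (he : IsTrivialAt (src C) e) :
    src (mk' C c hc) = mk' (src C) e he.1 := by
  obtain ⟨d, hd, c', hc', h⟩ := C.isCoset.exists_domVia hc
  unfold src
  rw [inv_mk' hc hd h, mul_mk' (src_inv C)]
  exact mk'_congr rfl ((IsTrivialAt.of_domVia_left h hd).equiv (src_src C) he) _ _

theorem rng_mk' {c e : S} (hc : c ∈ C.carrier) (he : IsTrivialAt (rng C) e) :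
    rng (mk' C c hc) = mk' (rng C) e he.1 := by
  obtain ⟨d, hd, c', hc', h⟩ := C.isCoset.exists_domVia hc
  unfold rng
  rw [inv_mk' hc hd h, mul_mk' (rng_inv C).symm]
  exact mk'_congr rfl ((IsTrivialAt.of_domVia_right h hd).equiv (src_rng C) he) _ _

theorem exists_isTrivialAt_src (C : T.Coset) : ∃ e, IsTrivialAt (src C) e := by
  obtain ⟨c, hc⟩ := C.nonempty
  obtain ⟨d, hd, c', hc', h⟩ := C.isCoset.exists_domVia hc
  exact ⟨_, .of_domVia_left h hd⟩

theorem base_src (x : T.CosetBundle) : (src x).base = src x.base :=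
  base_mul (x := GroupoidOps.inv x) (src_inv x.base)

theorem base_rng (x : T.CosetBundle) : (rng x).base = rng x.base :=
  base_mul (y := GroupoidOps.inv x) (rng_inv x.base).symm

theorem composable_iff {x y : T.CosetBundle} :
    GroupoidOps.Composable x y ↔ GroupoidOps.Composable x.base y.base := by
  unfold GroupoidOps.Composable
  refine ⟨fun h => by rw [← base_src, h, base_rng], fun h => ?_⟩
  obtain ⟨A, a, ha, rfl⟩ := x.exists_eq_mk'
  obtain ⟨B, b, hb, rfl⟩ := y.exists_eq_mk'
  change src A = rng B at h
  obtain ⟨e, he⟩ := exists_isTrivialAt_src A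
  rw [src_mk' ha he, rng_mk' hb (h ▸ he)]
  exact mk'_congr h (.refl (h ▸ he.1)) _ _

/-- The source germ is the class of any element trivial at the source coset, so it depends on the
base alone. Hence composability and injectivity on units are decided in the base. -/
theorem src_eq_src {x y : T.CosetBundle} (h : src x.base = src y.base) : src x = src y := by
  obtain ⟨A, a, ha, rfl⟩ := x.exists_eq_mk'
  obtain ⟨B, b, hb, rfl⟩ := y.exists_eq_mk'
  change src A = src B at h
  obtain ⟨e, he⟩ := exists_isTrivialAt_src A
  rw [src_mk' ha he, src_mk' hb (h ▸ he)]
  exact mk'_congr h (.refl (h ▸ he.1)) _ _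

theorem inv_inv (x : T.CosetBundle) : GroupoidOps.inv (GroupoidOps.inv x) = x := by
  obtain ⟨C, c, hc, rfl⟩ := x.exists_eq_mk'
  obtain ⟨d, hd, c', hc', h⟩ := C.isCoset.exists_domVia hc
  obtain ⟨q, hq, r, hr, k⟩ := C.isCoset.exists_domVia hd
  have hm : r * d * c' ∈ (GroupoidOps.inv C).carrier := C.isCoset.dual_mul_mem hr hd hc'
  -- The element `r d c'` of `C^*` is dominated by `c'` via `c`, so `c` represents the inverse of
  -- `[c', C^*]`.
  rw [inv_mk' hc hd h, inv_mk' hc' hm (h.switch (T.Z_le_N k.memZ_left))]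
  exact mk'_congr (Coset.inv_inv C) (.refl hc) _ _

theorem src_inv (x : T.CosetBundle) : src (GroupoidOps.inv x) = rng x := by
  unfold src rng; rw [inv_inv]

theorem rng_eq_rng {x y : T.CosetBundle} (h : rng x.base = rng y.base) : rng x = rng y := by
  rw [← src_inv, ← src_inv]
  exact src_eq_src (by rw [base_inv, base_inv, Coset.src_inv, Coset.src_inv, h])

theorem isGroupoid (T : StructuredSemigroup S) : IsGroupoid T.CosetBundle where
  inv_inv := inv_inv
  mul_src x := by
    obtain ⟨C, c, hc, rfl⟩ := x.exists_eq_mk'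
    obtain ⟨e, he⟩ := exists_isTrivialAt_src C
    rw [src_mk' hc he, mul_mk' (rng_src C).symm]
    exact mk'_congr (Coset.mul_src C) (he.mul_right_equiv hc) _ _
  rng_mul x := by
    obtain ⟨C, c, hc, rfl⟩ := x.exists_eq_mk'
    obtain ⟨e, he⟩ := exists_isTrivialAt_src (GroupoidOps.inv C)
    rw [Coset.src_inv] at he
    rw [rng_mk' hc he, mul_mk' (src_rng C)]
    exact mk'_congr (Coset.rng_mul C) (he.mul_left_equiv hc) _ _
  src_mul x y h := by
    rw [composable_iff] at h
    exact src_eq_src (by rw [base_mul h, Coset.src_mul h])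
  rng_mul_eq x y h := by
    rw [composable_iff] at h
    exact rng_eq_rng (by rw [base_mul h, Coset.rng_mul_eq h])
  mul_assoc x y z h k := by
    rw [composable_iff] at h k
    obtain ⟨A, a, ha, rfl⟩ := x.exists_eq_mk'
    obtain ⟨B, b, hb, rfl⟩ := y.exists_eq_mk'
    obtain ⟨C, c, hc, rfl⟩ := z.exists_eq_mk'
    have h' : GroupoidOps.Composable A B := h
    have k' : GroupoidOps.Composable B C := k
    have h₁ : GroupoidOps.Composable (GroupoidOps.mul A B) C := (Coset.src_mul h').trans k'
    have h₂ : GroupoidOps.Composable A (GroupoidOps.mul B C) :=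
      h'.trans (Coset.rng_mul_eq k').symm
    rw [mul_mk' h', mul_mk' k', mul_mk' h₁, mul_mk' h₂]
    refine mk'_congr (Coset.mul_assoc' h' k') ?_ _ _
    rw [mul_assoc]
    exact .refl (mul_mem_mul h₂ ha (mul_mem_mul k' hb hc))

end CosetBundle

end Germs

end StructuredSemigroup

/-! ### General facts on groupoids and groupoid bundles -/

namespace IsGroupoid

variable {G : Type*} [GroupoidOps G] (hG : IsGroupoid G)

include hG

theorem src_inv (g : G) : src (inv g) = rng g := by
  unfold src rng; rw [hG.inv_inv]

theorem rng_inv (g : G) : rng (inv g) = src g := by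
  unfold src rng; rw [hG.inv_inv]

theorem src_src (g : G) : src (src g) = src g :=
  hG.src_mul (inv g) g (hG.src_inv g)

theorem rng_src (g : G) : rng (src g) = src g :=
  (hG.rng_mul_eq (inv g) g (hG.src_inv g)).trans (hG.rng_inv g)

theorem src_rng (g : G) : src (rng g) = rng g := by
  rw [← hG.src_inv, hG.src_src]

theorem mem_units_iff {g : G} : g ∈ units G ↔ src g = g := by
  constructor
  · rintro ⟨h, k⟩
    calc src g = mul (inv g) (mul g g) := by rw [k]; rfl
      _ = mul (src g) g := (hG.mul_assoc _ _ _ (hG.src_inv g) h).symm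
      _ = g := by rw [show src g = rng g from h, hG.rng_mul]
  · intro h
    refine ⟨?_, ?_⟩
    · unfold Composable
      conv_rhs => rw [← h, hG.rng_src]
    · conv_lhs => arg 2; rw [← h]
      exact hG.mul_src g

theorem rng_eq_of_mem_units {g : G} (h : g ∈ units G) : rng g = g := by
  rw [hG.mem_units_iff] at h
  rw [← h, hG.rng_src, h]

theorem src_mem_units (g : G) : src g ∈ units G := hG.mem_units_iff.2 (hG.src_src g)

theorem rng_mem_units (g : G) : rng g ∈ units G := hG.mem_units_iff.2 (hG.src_rng g)

theorem mul_right_cancel {e f g : G} (he : Composable e g) (hf : Composable f g)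
    (h : mul e g = mul f g) : e = f := by
  have key : ∀ {e : G}, Composable e g → mul (mul e g) (inv g) = e := fun {e} he => by
    rw [hG.mul_assoc _ _ _ he (hG.rng_inv g).symm]
    change mul e (rng g) = e
    rw [← show src e = rng g from he, hG.mul_src]
  rw [← key he, h, key hf]

theorem mul_left_cancel {e f g : G} (he : Composable g e) (hf : Composable g f)
    (h : mul g e = mul g f) : e = f := by
  have key : ∀ {e : G}, Composable g e → mul (inv g) (mul g e) = e := fun {e} he => by
    rw [← hG.mul_assoc _ _ _ (hG.src_inv g) he]
    change mul (src g) e = e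
    rw [show src g = rng e from he, hG.rng_mul]
  rw [← key he, h, key hf]

end IsGroupoid

namespace IsGroupoidBundle

variable {F G : Type*} [GroupoidOps F] [GroupoidOps G] [TopologicalSpace F] [TopologicalSpace G]
  {π : F → G} (hπ : IsGroupoidBundle π)

include hπ

theorem map_mem_units {e : F} (he : e ∈ units F) : π e ∈ units G :=
  ⟨hπ.map_composable _ _ he.1, by rw [← hπ.map_mul _ _ he.1, he.2]⟩

theorem map_src (e : F) : π (src e) = src (π e) := by
  have hF := hπ.total.toIsGroupoid
  have h : Composable (π e) (π (src e)) := hπ.map_composable _ _ (hF.rng_src e).symm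
  rw [show src (π e) = rng (π (src e)) from h,
    hπ.base.toIsGroupoid.rng_eq_of_mem_units (hπ.map_mem_units (hF.src_mem_units e))]

theorem map_rng (e : F) : π (rng e) = rng (π e) := by
  have hF := hπ.total.toIsGroupoid
  have h : Composable (π (rng e)) (π e) := hπ.map_composable _ _ (hF.src_rng e)
  rw [← show src (π (rng e)) = rng (π e) from h,
    hπ.base.toIsGroupoid.mem_units_iff.1 (hπ.map_mem_units (hF.rng_mem_units e))]

/-- The units `src e` and `rng f` have the same image, and `π` is injective on units. -/
theorem composable_of_map {e f : F} (h : Composable (π e) (π f)) : Composable e f := by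
  have hF := hπ.total.toIsGroupoid
  refine hπ.injOn_units (hF.src_mem_units e) (hF.rng_mem_units f) ?_
  rw [hπ.map_src, hπ.map_rng]; exact h

end IsGroupoidBundle

namespace StructuredSemigroup

/-! ### Topology of the coset bundle and its canonical slice-sections -/

section CosetBundleRep

variable {S : Type*} [Semigroup S] {T : StructuredSemigroup S} {C : T.Coset}

theorem Coset.continuous_rng (T : StructuredSemigroup S) :
    Continuous (rng : T.Coset → T.Coset) :=
  (Coset.continuous_mul T).comp (Continuous.subtype_mk
    (continuous_id.prodMk (Coset.continuous_inv T)) fun C => (Coset.rng_inv C).symm)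

namespace CosetBundle

theorem isOpen_range_mk' (T : StructuredSemigroup S) (s : S) :
    IsOpen {x : T.CosetBundle | ∃ C, ∃ hs : s ∈ C.carrier, x = mk' C s hs} :=
  .basic _ (.inl ⟨s, rfl⟩)

theorem continuous_base (T : StructuredSemigroup S) :
    Continuous (CosetBundle.base : T.CosetBundle → T.Coset) := by
  refine continuous_generateFrom_iff.2 ?_
  rintro _ ⟨a, rfl⟩
  exact .basic _ (.inr ⟨a, rfl⟩)

/-- An equality `[c, C] = [s, C]` is witnessed by one `z` in the range of `C`, and the same `z`
works for all nearby cosets. -/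
theorem continuous_mk' (T : StructuredSemigroup S) (c : S) :
    Continuous fun C : {C : T.Coset | c ∈ C.carrier} => mk' C.1 c C.2 := by
  refine continuous_generateFrom_iff.2 ?_
  rintro _ (⟨s, rfl⟩ | ⟨s, rfl⟩)
  · refine isOpen_iff_mem_nhds.2 fun C ⟨D, hD, e⟩ => ?_
    obtain rfl : C.1 = D := congrArg CosetBundle.base e
    obtain ⟨-, -, z, hz, hzC, h⟩ := equiv_iff.1 ((mk'_eq_iff C.2 hD).1 e)
    have h₁ : IsOpen {E : {C : T.Coset | c ∈ C.carrier} |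
        s ∈ E.1.carrier ∧ z ∈ (rng E.1).carrier} :=
      ((Coset.isOpen_mem T s).preimage continuous_subtype_val).inter
        ((Coset.isOpen_mem T z).preimage
          ((Coset.continuous_rng T).comp continuous_subtype_val))
    refine Filter.mem_of_superset (h₁.mem_nhds ⟨hD, hzC⟩) fun E hE => ?_
    exact ⟨E.1, hE.1, (mk'_eq_iff E.2 hE.1).2 (equiv_iff.2 ⟨E.2, hE.1, z, hz, hE.2, h⟩)⟩
  · exact (Coset.isOpen_mem T s).preimage continuous_subtype_val

theorem isOpenMap_base (T : StructuredSemigroup S) :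
    IsOpenMap (CosetBundle.base : T.CosetBundle → T.Coset) := by
  intro O hO
  refine isOpen_iff_mem_nhds.2 ?_
  rintro _ ⟨x, hx, rfl⟩
  obtain ⟨C, c, hc, rfl⟩ := x.exists_eq_mk'
  have ho := (Coset.isOpen_mem T c).isOpenMap_subtype_val _ (hO.preimage (continuous_mk' T c))
  refine Filter.mem_of_superset (ho.mem_nhds ⟨⟨C, hc⟩, hx, rfl⟩) ?_
  rintro _ ⟨D, hD, rfl⟩
  exact ⟨_, hD, rfl⟩

theorem continuous_inv (T : StructuredSemigroup S) :
    Continuous (GroupoidOps.inv : T.CosetBundle → T.CosetBundle) := by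
  refine continuous_generateFrom_iff.2 ?_
  rintro _ (⟨s, rfl⟩ | ⟨s, rfl⟩)
  · refine isOpen_iff_mem_nhds.2 fun x ⟨D, hD, e⟩ => ?_
    obtain ⟨d, hd, s', hs', h⟩ := D.isCoset.exists_domVia hD
    obtain ⟨q, hq, r, hr, k⟩ := D.isCoset.exists_domVia hd
    have hm : r * d * s' ∈ (GroupoidOps.inv D).carrier := D.isCoset.dual_mul_mem hr hd hs'
    have hsw : T.DomVia (r * d * s') s s' := h.switch (T.Z_le_N k.memZ_left)
    have hx : x = mk' (GroupoidOps.inv D) s' hs' := by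
      rw [← inv_inv x, e, inv_mk' hD hd h]
    -- On germs `[s', E]` with `r d s' ∈ E`, inversion is uniformly `[s', E] ↦ [s, E^*]`, because
    -- `s'` dominates `r d s'` via `s`.
    refine Filter.mem_of_superset (((isOpen_range_mk' T s').inter
      ((Coset.isOpen_mem T (r * d * s')).preimage (continuous_base T))).mem_nhds
        ⟨⟨_, hs', hx⟩, ?_⟩) ?_
    · rw [Set.mem_preimage, hx]; exact hm
    · rintro _ ⟨⟨E, hE, rfl⟩, hE'⟩
      exact ⟨_, Coset.mem_inv_of_domVia hE' hsw, inv_mk' hE hE' hsw⟩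
  · exact (Coset.isOpen_mem T s).preimage ((Coset.continuous_inv T).comp (continuous_base T))

theorem continuous_base_mul (T : StructuredSemigroup S) :
    Continuous fun p : {p : T.CosetBundle × T.CosetBundle // Composable p.1 p.2} =>
      GroupoidOps.mul p.1.1.base p.1.2.base :=
  (Coset.continuous_mul T).comp (Continuous.subtype_mk
    (((continuous_base T).comp (continuous_fst.comp continuous_subtype_val)).prodMk
      ((continuous_base T).comp (continuous_snd.comp continuous_subtype_val)))
    fun p => composable_iff.1 p.2)

theorem continuous_mul (T : StructuredSemigroup S) :
    Continuous fun p : {p : T.CosetBundle × T.CosetBundle // Composable p.1 p.2} =>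
      GroupoidOps.mul p.1.1 p.1.2 := by
  refine continuous_generateFrom_iff.2 ?_
  rintro _ (⟨s, rfl⟩ | ⟨s, rfl⟩)
  · refine isOpen_iff_mem_nhds.2 ?_
    rintro ⟨⟨x, y⟩, hxy⟩ ⟨D, hD, e⟩
    have hxy' := composable_iff.1 hxy
    obtain ⟨A, a, ha, rfl⟩ := x.exists_eq_mk'
    obtain ⟨B, b, hb, rfl⟩ := y.exists_eq_mk'
    change GroupoidOps.Composable A B at hxy'
    change GroupoidOps.mul (mk' A a ha) (mk' B b hb) = _ at e
    rw [mul_mk' hxy'] at e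
    obtain rfl : GroupoidOps.mul A B = D := congrArg CosetBundle.base e
    -- With the representatives `a`, `b` held fixed, this `z` still proves `[ab, A'B'] = [s, A'B']`
    -- whenever the nearby product `A'B'` contains `s` and its range contains `z`.
    obtain ⟨-, -, z, hz, hzC, h⟩ := equiv_iff.1 ((mk'_eq_iff _ hD).1 e)
    have h₁ : Continuous fun p : {p : T.CosetBundle × T.CosetBundle // Composable p.1 p.2} =>
      p.1.1 := continuous_fst.comp continuous_subtype_val
    have h₂ : Continuous fun p : {p : T.CosetBundle × T.CosetBundle // Composable p.1 p.2} =>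
      p.1.2 := continuous_snd.comp continuous_subtype_val
    refine Filter.mem_of_superset (((((isOpen_range_mk' T a).preimage h₁).inter
      ((isOpen_range_mk' T b).preimage h₂)).inter
      (((Coset.isOpen_mem T s).preimage (continuous_base_mul T)).inter
        ((Coset.isOpen_mem T z).preimage
          ((Coset.continuous_rng T).comp (continuous_base_mul T))))).mem_nhds
        ⟨⟨⟨A, ha, rfl⟩, ⟨B, hb, rfl⟩⟩, hD, hzC⟩) ?_
    rintro ⟨⟨_, _⟩, hxy⟩ ⟨⟨⟨A', ha', rfl⟩, ⟨B', hb', rfl⟩⟩, hs, hz'⟩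
    have hc : GroupoidOps.Composable A' B' := composable_iff.1 hxy
    refine ⟨GroupoidOps.mul A' B', hs, (mul_mk' hc ha' hb').trans ((mk'_eq_iff _ _).2 ?_)⟩
    exact equiv_iff.2 ⟨Coset.mul_mem_mul hc ha' hb', hs, z, hz, hz', h⟩
  · refine Eq.subst (motive := IsOpen) (Set.ext fun p => ?_)
      ((Coset.isOpen_mem T s).preimage (continuous_base_mul T))
    change s ∈ (GroupoidOps.mul p.1.1.base p.1.2.base).carrier ↔
      s ∈ (GroupoidOps.mul p.1.1 p.1.2).base.carrier
    rw [base_mul (composable_iff.1 p.2)]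

end CosetBundle

open CosetBundle

theorem isGroupoidBundle_cosetBundle (T : StructuredSemigroup S) :
    IsGroupoidBundle T.cosetBundle where
  total :=
    { CosetBundle.isGroupoid T with
      continuous_inv := CosetBundle.continuous_inv T
      continuous_mul := CosetBundle.continuous_mul T }
  base := Coset.isEtaleGroupoid T
  isOpenMap := isOpenMap_base T
  continuous := continuous_base T
  map_composable _ _ := composable_iff.1
  map_mul _ _ h := base_mul (composable_iff.1 h)
  injOn_units x hx y hy h := by
    rw [(CosetBundle.isGroupoid T).mem_units_iff] at hx hy
    rw [← hx, ← hy]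
    exact src_eq_src (congrArg src h)

theorem isSliceSection_cosetBundleRep (T : StructuredSemigroup S) (a : S) :
    IsSliceSection T.cosetBundle (T.cosetBundleRep a) where
  isOpen_dom := Coset.isOpen_mem T a
  isSlice_dom := Coset.isSlice_mem T a
  continuous := continuous_mk' T a
  section_eq := by
    rintro C _ ⟨h, rfl⟩
    rfl

theorem isSectionProduct_cosetBundleRep (hZ : IsSymmetricSubset (T.Z : Set S)) (a b : S) :
    IsSectionProduct (T.cosetBundleRep a) (T.cosetBundleRep b) (T.cosetBundleRep (a * b)) := by
  intro C x
  constructor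
  · rintro ⟨h, rfl⟩
    obtain ⟨A, B, ha, hb, hAB, rfl⟩ := Coset.exists_mul_eq_of_mul_mem hZ h
    exact ⟨A, B, _, _, ⟨ha, rfl⟩, ⟨hb, rfl⟩, hAB, rfl, (mul_mk' hAB ha hb).symm⟩
  · rintro ⟨A, B, _, _, ⟨ha, rfl⟩, ⟨hb, rfl⟩, hAB, rfl, rfl⟩
    exact ⟨Coset.mul_mem_mul hAB ha hb, (mul_mk' hAB ha hb).symm⟩

end CosetBundleRep

end StructuredSemigroup

/-- The domain of a product of slice-sections is the product of their domains. -/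
theorem IsSectionProduct.dom_eq {F G : Type*} [GroupoidOps F] [GroupoidOps G] {a b c : G →. F}
    (h : IsSectionProduct a b c) : c.Dom = setMul a.Dom b.Dom := by
  ext k
  constructor
  · intro hk
    obtain ⟨g, g', x, y, hx, hy, hc, hm, -⟩ := (h k _).1 (Part.get_mem hk)
    exact ⟨g, Part.dom_iff_mem.2 ⟨x, hx⟩, g', Part.dom_iff_mem.2 ⟨y, hy⟩, hc, hm.symm⟩
  · rintro ⟨g, hg, g', hg', hc, hm⟩
    exact Part.dom_iff_mem.2 ⟨_, (h k _).2
      ⟨g, g', _, _, Part.get_mem hg, Part.get_mem hg', hc, hm.symm, rfl⟩⟩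

/-! ### The coset bundle representation, and cosets arising from arbitrary representations -/

namespace StructuredSemigroup

variable {S : Type*} [Semigroup S] {T : StructuredSemigroup S}

theorem isBundleRep_cosetBundleRep (hZ : IsSymmetricSubset (T.Z : Set S)) :
    T.IsBundleRep T.cosetBundle T.cosetBundleRep where
  bundle := isGroupoidBundle_cosetBundle T
  isSliceSection := isSliceSection_cosetBundleRep T
  map_mul := isSectionProduct_cosetBundleRep hZ
  etaleRep :=
    { etale := Coset.isEtaleGroupoid T
      isOpen := Coset.isOpen_mem T
      isSlice := Coset.isSlice_mem T
      map_mul := fun a b => (isSectionProduct_cosetBundleRep hZ a b).dom_eq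
      cover := fun C => C.nonempty
      map_N := fun n hn C hC =>
        (Coset.isGroupoid T).mem_units_iff.2 (Coset.src_eq_of_mem_N hn hC)
      locally_round := fun C a ha => by
        obtain ⟨b, hb, s, -, h⟩ := C.isCoset.exists_domVia ha
        exact ⟨b, ⟨s, h⟩, hb⟩ }

theorem cosetBundleRep_injective_iff : Function.Injective T.cosetBundleRep ↔
    ∀ a b : S, a ≠ b →
      ∃ C : T.Coset, (({a, b} : Set S) ∩ C.carrier).Nonempty ∧ ¬ T.Equiv C.carrier a b := by
  constructor
  · intro hinj a b hab
    by_contra! hno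
    refine hab (hinj (funext fun C => Part.ext fun x => ⟨?_, ?_⟩))
    · rintro ⟨ha, rfl⟩
      have h := hno C ⟨a, .inl rfl, ha⟩
      exact ⟨h.mem_right, ((CosetBundle.mk'_eq_iff ha h.mem_right).2 h).symm⟩
    · rintro ⟨hb, rfl⟩
      have h := hno C ⟨b, .inr rfl, hb⟩
      exact ⟨h.mem_left, (CosetBundle.mk'_eq_iff h.mem_left hb).2 h⟩
  · intro h a b hab
    by_contra hne
    obtain ⟨C, ⟨c, hc, hcC⟩, hC⟩ := h a b hne
    have hiff : a ∈ C.carrier ↔ b ∈ C.carrier :=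
      iff_of_eq (congrArg (fun p => (p C).Dom) hab)
    have ha : a ∈ C.carrier := by
      rcases hc with rfl | rfl
      · exact hcC
      · exact hiff.2 hcC
    have hm : CosetBundle.mk' C a ha ∈ T.cosetBundleRep b C := by
      rw [← hab]; exact ⟨ha, rfl⟩
    obtain ⟨hb, e⟩ := hm
    exact hC ((CosetBundle.mk'_eq_iff ha hb).1 e.symm)

namespace IsEtaleRep

variable {G : Type*} [GroupoidOps G] [TopologicalSpace G] {θ : S → Set G} (hθ : T.IsEtaleRep θ)

include hθ

/-- From `a = (as)b` the arrow factors as `g = m l` with `m` a unit, so `g = l ∈ θ b`. Writing `m =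
p k` with `p ∈ θ a` and `k ∈ θ s`, the arrow `p` has the range of `g`, so `p = g` as `θ a` is a
slice, and `k = g⁻¹`. -/
theorem mem_of_domVia {a s b : S} (h : T.DomVia a s b) {g : G} (hg : g ∈ θ a) :
    g ∈ θ b ∧ inv g ∈ θ s := by
  have hG := hθ.etale.toIsGroupoid
  have hg' := hg
  rw [← h.right, hθ.map_mul] at hg'
  obtain ⟨m, hm, l, hl, hml, rfl⟩ := hg'
  have hmu := hθ.map_N _ h.memN_right hm
  have e₁ : mul m l = l := by
    rw [← hG.mem_units_iff.1 hmu, show src m = rng l from hml, hG.rng_mul]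
  rw [e₁] at hg ⊢
  refine ⟨hl, ?_⟩
  rw [hθ.map_mul] at hm
  obtain ⟨p, hp, k, hk, hpk, rfl⟩ := hm
  have e₂ : mul p k = rng l := by
    rw [← hml, hG.mem_units_iff.1 hmu]
  obtain rfl : p = l := (hθ.isSlice a).2 hp hg (by
    rw [← hG.rng_mul_eq p k hpk, e₂, hG.rng_eq_of_mem_units (hG.rng_mem_units l)])
  have : inv p = k := hG.mul_left_cancel (g := p) (hG.rng_inv p).symm hpk e₂.symm
  rwa [this]

theorem inv_mem_of_mem_dual {g : G} {s : S} (hs : s ∈ T.dual {a | g ∈ θ a}) : inv g ∈ θ s := by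
  obtain ⟨a, ha, b, h⟩ := hs
  exact (hθ.mem_of_domVia h ha).2

theorem isCoset_setOf_mem (g : G) : T.IsCoset {a | g ∈ θ a} := by
  have hG := hθ.etale.toIsGroupoid
  refine ⟨?_, Set.Subset.antisymm ?_ ?_⟩
  · rintro _ ⟨_, ⟨a, ha, s, hs, rfl⟩, c, hc, rfl⟩
    change g ∈ θ (a * s * c)
    rw [hθ.map_mul, hθ.map_mul]
    exact ⟨rng g, ⟨g, ha, inv g, hθ.inv_mem_of_mem_dual hs, (hG.rng_inv g).symm, rfl⟩, g, hc,
      hG.src_rng g, hG.rng_mul g⟩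
  · intro a ha
    obtain ⟨b, hb, hg⟩ := hθ.locally_round g a ha
    exact ⟨b, hg, hb⟩
  · rintro b ⟨a, ha, s, h⟩
    exact (hθ.mem_of_domVia h ha).1

/-- The coset of all elements whose image contains a given arrow. -/
def coset (g : G) : T.Coset := ⟨{a | g ∈ θ a}, hθ.isCoset_setOf_mem g, hθ.cover g⟩

end IsEtaleRep

/-- Equivalent elements of the coset at `g` are represented by the same value at `g`. -/
theorem IsBundleRep.eq_of_equiv {F G : Type*} [GroupoidOps F] [GroupoidOps G]
    [TopologicalSpace F] [TopologicalSpace G] {π : F → G} {θ : S → (G →. F)}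
    (hθ : T.IsBundleRep π θ) {a b : S} {g : G} (h : T.Equiv (hθ.etaleRep.coset g).carrier a b)
    {x y : F} (hx : x ∈ θ a g) (hy : y ∈ θ b g) : x = y := by
  have hG := hθ.bundle.base.toIsGroupoid
  have hF := hθ.bundle.total.toIsGroupoid
  obtain ⟨-, -, s, hs, t, ht, e⟩ := h
  obtain ⟨p, hp⟩ := Part.dom_iff_mem.1 (hθ.etaleRep.inv_mem_of_mem_dual hs)
  obtain ⟨q, hq⟩ := Part.dom_iff_mem.1 (hθ.etaleRep.inv_mem_of_mem_dual ht)
  have hsec : ∀ {c : S} {g : G} {f : F}, f ∈ θ c g → π f = g := fun h =>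
    (hθ.isSliceSection _).section_eq _ _ h
  have c₁ : Composable (inv g) g := hG.src_inv g
  have c₂ : Composable (mul (inv g) g) (inv g) := (hG.src_src g).trans (hG.rng_inv g).symm
  have key : ∀ {c : S} {z : F}, z ∈ θ c g → Composable p z ∧ Composable (mul p z) q ∧
      mul (mul p z) q ∈ θ (s * c * t) (mul (mul (inv g) g) (inv g)) := by
    intro c z hz
    have h₁ : mul p z ∈ θ (s * c) (mul (inv g) g) :=
      (hθ.map_mul s c _ _).2 ⟨_, _, p, z, hp, hz, c₁, rfl, rfl⟩
    refine ⟨hθ.bundle.composable_of_map ?_, hθ.bundle.composable_of_map ?_,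
      (hθ.map_mul (s * c) t _ _).2 ⟨_, _, _, q, h₁, hq, c₂, rfl, rfl⟩⟩
    · rwa [hsec hp, hsec hz]
    · rwa [hsec h₁, hsec hq]
  obtain ⟨hx₁, hx₂, hx₃⟩ := key hx
  obtain ⟨hy₁, hy₂, hy₃⟩ := key hy
  rw [e] at hx₃
  exact hF.mul_left_cancel hx₁ hy₁ (hF.mul_right_cancel hx₂ hy₂ (Part.mem_unique hx₃ hy₃))

/-- Otherwise the coset of each arrow `g` at which `θ a` or `θ b` is defined would contain both
elements and identify them, forcing `θ a = θ b`. -/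
theorem IsBundleRep.exists_not_equiv {F G : Type*} [GroupoidOps F] [GroupoidOps G]
    [TopologicalSpace F] [TopologicalSpace G] {π : F → G} {θ : S → (G →. F)}
    (hθ : T.IsBundleRep π θ) (hinj : Function.Injective θ) {a b : S} (hab : a ≠ b) :
    ∃ C : T.Coset, (({a, b} : Set S) ∩ C.carrier).Nonempty ∧ ¬ T.Equiv C.carrier a b := by
  by_contra! hno
  refine hab (hinj (funext fun g => Part.ext fun x => ⟨fun hx => ?_, fun hx => ?_⟩))
  · have h := hno (hθ.etaleRep.coset g) ⟨a, .inl rfl, Part.dom_iff_mem.2 ⟨x, hx⟩⟩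
    obtain ⟨y, hy⟩ := Part.dom_iff_mem.1 h.mem_right
    rwa [hθ.eq_of_equiv h hx hy]
  · have h := hno (hθ.etaleRep.coset g) ⟨b, .inr rfl, Part.dom_iff_mem.2 ⟨x, hx⟩⟩
    obtain ⟨y, hy⟩ := Part.dom_iff_mem.1 h.mem_left
    rwa [← hθ.eq_of_equiv h hy hx]

end StructuredSemigroup

/-! ### Transport of bundle representations to a larger universe -/

section Lift

variable {F G : Type*}

/-- A partial function, regarded as one between lifted types. -/
def PFun.ulift (a : G →. F) : ULift G →. ULift F := fun g => (a g.down).map ULift.up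

theorem PFun.mem_ulift {a : G →. F} {g : ULift G} {f : ULift F} :
    f ∈ a.ulift g ↔ f.down ∈ a g.down := by
  refine (Part.mem_map_iff _).trans ⟨?_, fun h => ⟨_, h, rfl⟩⟩
  rintro ⟨f, hf, rfl⟩
  exact hf

theorem PFun.ulift_injective : Function.Injective (PFun.ulift : (G →. F) → _) := by
  intro a b h
  refine funext fun g => Part.ext fun f => ?_
  have := congrArg (fun p => ULift.up f ∈ p ⟨g⟩) h
  exact PFun.mem_ulift.symm.trans ((iff_of_eq this).trans PFun.mem_ulift)

instance [GroupoidOps G] : GroupoidOps (ULift G) where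
  inv g := ⟨inv g.down⟩
  mul g h := ⟨mul g.down h.down⟩

variable [GroupoidOps F] [GroupoidOps G]

theorem ULift.composable_iff {g h : ULift G} : Composable g h ↔ Composable g.down h.down :=
  ULift.ext_iff

theorem ULift.mem_units_iff {g : ULift G} : g ∈ units (ULift G) ↔ g.down ∈ units G :=
  and_congr ULift.composable_iff ULift.ext_iff

theorem IsSlice.preimage_down {B : Set G} (hB : IsSlice B) :
    IsSlice (ULift.down ⁻¹' B : Set (ULift G)) :=
  ⟨fun _ hg _ hh e => ULift.ext _ _ (hB.1 hg hh (congrArg ULift.down e)),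
    fun _ hg _ hh e => ULift.ext _ _ (hB.2 hg hh (congrArg ULift.down e))⟩

theorem IsGroupoid.ulift (hG : IsGroupoid G) : IsGroupoid (ULift G) where
  inv_inv g := ULift.ext _ _ (hG.inv_inv g.down)
  mul_src g := ULift.ext _ _ (hG.mul_src g.down)
  rng_mul g := ULift.ext _ _ (hG.rng_mul g.down)
  src_mul _ _ h := ULift.ext _ _ (hG.src_mul _ _ (ULift.composable_iff.1 h))
  rng_mul_eq _ _ h := ULift.ext _ _ (hG.rng_mul_eq _ _ (ULift.composable_iff.1 h))
  mul_assoc _ _ _ h k := ULift.ext _ _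
    (hG.mul_assoc _ _ _ (ULift.composable_iff.1 h) (ULift.composable_iff.1 k))

theorem IsSectionProduct.ulift {a b c : G →. F} (h : IsSectionProduct a b c) :
    IsSectionProduct a.ulift b.ulift c.ulift := by
  intro k f
  rw [PFun.mem_ulift, h]
  constructor
  · rintro ⟨g, g', x, y, hx, hy, hc, hk, hf⟩
    exact ⟨⟨g⟩, ⟨g'⟩, ⟨x⟩, ⟨y⟩, PFun.mem_ulift.2 hx, PFun.mem_ulift.2 hy,
      ULift.composable_iff.2 hc, ULift.ext _ _ hk, ULift.ext _ _ hf⟩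
  · rintro ⟨g, g', x, y, hx, hy, hc, hk, hf⟩
    exact ⟨g.down, g'.down, x.down, y.down, PFun.mem_ulift.1 hx, PFun.mem_ulift.1 hy,
      ULift.composable_iff.1 hc, congrArg ULift.down hk, congrArg ULift.down hf⟩

variable [TopologicalSpace F] [TopologicalSpace G]

theorem IsTopologicalGroupoid.ulift (hG : IsTopologicalGroupoid G) :
    IsTopologicalGroupoid (ULift G) where
  __ := hG.toIsGroupoid.ulift
  continuous_inv := continuous_uliftUp.comp (hG.continuous_inv.comp continuous_uliftDown)
  continuous_mul := by
    have h : Continuous fun p : {p : ULift G × ULift G // Composable p.1 p.2} =>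
        (⟨(p.1.1.down, p.1.2.down), ULift.composable_iff.1 p.2⟩ :
          {p : G × G // Composable p.1 p.2}) :=
      Continuous.subtype_mk
        ((continuous_uliftDown.comp (continuous_fst.comp continuous_subtype_val)).prodMk
          (continuous_uliftDown.comp (continuous_snd.comp continuous_subtype_val))) _
    exact continuous_uliftUp.comp (hG.continuous_mul.comp h)

theorem IsEtaleGroupoid.ulift (hG : IsEtaleGroupoid G) : IsEtaleGroupoid (ULift G) where
  __ := hG.toIsTopologicalGroupoid.ulift
  isOpenMap_src := Homeomorph.ulift.symm.isOpenMap.comp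
    (hG.isOpenMap_src.comp Homeomorph.ulift.isOpenMap)

theorem IsGroupoidBundle.ulift {π : F → G} (hπ : IsGroupoidBundle π) :
    IsGroupoidBundle fun f : ULift F => (ULift.up (π f.down) : ULift G) where
  total := hπ.total.ulift
  base := hπ.base.ulift
  isOpenMap := Homeomorph.ulift.symm.isOpenMap.comp (hπ.isOpenMap.comp Homeomorph.ulift.isOpenMap)
  continuous := continuous_uliftUp.comp (hπ.continuous.comp continuous_uliftDown)
  map_composable _ _ h := ULift.composable_iff.2
    (hπ.map_composable _ _ (ULift.composable_iff.1 h))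
  map_mul _ _ h := ULift.ext _ _ (hπ.map_mul _ _ (ULift.composable_iff.1 h))
  injOn_units _ he _ hf h := ULift.ext _ _ (hπ.injOn_units (ULift.mem_units_iff.1 he)
    (ULift.mem_units_iff.1 hf) (congrArg ULift.down h))

omit [GroupoidOps F] in
theorem IsSliceSection.ulift {π : F → G} {a : G →. F} (ha : IsSliceSection π a) :
    IsSliceSection (fun f : ULift F => (ULift.up (π f.down) : ULift G)) a.ulift where
  isOpen_dom := ha.isOpen_dom.preimage continuous_uliftDown
  isSlice_dom := IsSlice.preimage_down ha.isSlice_dom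
  continuous := continuous_uliftUp.comp (ha.continuous.comp (Continuous.subtype_mk
    (continuous_uliftDown.comp continuous_subtype_val) fun g => g.2))
  section_eq _ _ h := ULift.ext _ _ (ha.section_eq _ _ (PFun.mem_ulift.1 h))

namespace StructuredSemigroup

variable {S : Type*} [Semigroup S] {T : StructuredSemigroup S}

theorem IsBundleRep.ulift {π : F → G} {θ : S → (G →. F)} (hθ : T.IsBundleRep π θ) :
    T.IsBundleRep (fun f : ULift F => (ULift.up (π f.down) : ULift G))
      fun a => (θ a).ulift where
  bundle := hθ.bundle.ulift
  isSliceSection a := (hθ.isSliceSection a).ulift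
  map_mul a b := (hθ.map_mul a b).ulift
  etaleRep :=
    { etale := hθ.etaleRep.etale.ulift
      isOpen := fun a => (hθ.isSliceSection a).ulift.isOpen_dom
      isSlice := fun a => (hθ.isSliceSection a).ulift.isSlice_dom
      map_mul := fun a b => (hθ.map_mul a b).ulift.dom_eq
      cover := fun g => hθ.etaleRep.cover g.down
      map_N := fun n hn _ hg => ULift.mem_units_iff.2 (hθ.etaleRep.map_N n hn hg)
      locally_round := fun g => hθ.etaleRep.locally_round g.down }

end StructuredSemigroup

end Lift

theorem corollary10p3 {S : Type u} [Semigroup S] (T : StructuredSemigroup S)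
    (hZ : IsSymmetricSubset (T.Z : Set S)) :
    T.IsBundleRep T.cosetBundle T.cosetBundleRep ∧
    List.TFAE
      [T.HasFaithfulBundleRep.{u, v},
       Function.Injective T.cosetBundleRep,
       ∀ a b : S, a ≠ b →
         ∃ C : T.Coset, (({a, b} : Set S) ∩ C.carrier).Nonempty ∧ ¬ T.Equiv C.carrier a b] := by
  have hT := StructuredSemigroup.isBundleRep_cosetBundleRep hZ
  refine ⟨hT, ?_⟩
  tfae_have 1 → 3 := fun ⟨_, _, _, _, _, _, _, _, hθ, hinj⟩ _ _ hab => hθ.exists_not_equiv hinj hab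
  tfae_have 3 → 2 := StructuredSemigroup.cosetBundleRep_injective_iff.2
  -- The coset bundle lives in the universe of `S`; lifting places it in the universe in which a
  -- faithful bundle is sought.
  tfae_have 2 → 1 := fun h => ⟨ULift.{max u v} T.CosetBundle, ULift.{max u v} T.Coset, _, _, _, _,
    _, _, hT.ulift, PFun.ulift_injective.comp h⟩
  tfae_finish
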